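/- All vector spaces are over $\mathbb C$; $x_0,x_1,x_2,x_3,x,z$ are commuting formal variables. $\mathbb C_*(x_1,\dots,x_n)$ denotes the localization of $\mathbb C[[x_1,\dots,x_n]]$ at the nonzero polynomials, and $\iota_{x_1,x_2}:\mathbb C_*(x_1,x_2)\to\mathbb C((x_1))((x_2))$ is the unique ring embedding extending the inclusion of $\mathbb C[[x_1,x_2]]$ ($\iota_{x_2,x_1}$ is defined likewise, with values in $\mathbb C((x_2))((x_1))$). A *nonlocal vertex algebra* is a vector space $V$ with a linear map $Y(\cdot,x):V\to\mathrm{Hom}(V,V((x)))$ and a vector $\mathbf 1\in V$ such that $Y(\mathbf 1,x)v=v$, $Y(v,x)\mathbf 1\in V[[x]]$ with constant term $v$, and for all $u,v,w\in V$ there is $l\ge 0$ with $(x_0+x_2)^lY(u,x_0+x_2)Y(v,x_2)w=(x_0+x_2)^lY(Y(u,x_0)v,x_2)w$. Let $\mathcal D v$ be the coefficient of $x$ in $Y(v,x)\mathbf 1$. A *quasi $V$-module* is a vector space $W$ with a linear map $Y_W(\cdot,x):V\to\mathrm{Hom}(W,W((x)))$ such that $Y_W(\mathbf 1,x)=1_W$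 and for all $u,v\in V$, $w\in W$ there is a nonzero polynomial $f(x_1,x_2)$ with $f(x_0+x_2,x_2)Y_W(u,x_0+x_2)Y_W(v,x_2)w=f(x_0+x_2,x_2)Y_W(Y(u,x_0)v,x_2)w$. (Powers of $x_0+x_2$ are expanded in nonnegative powers of $x_2$.) It is *pseudo-local* if for all $u,v\in V$ there are finitely many $v^{(i)},u^{(i)}\in V$ and $f_i\in\mathbb C_*(x_1,x_2)$ such that, for some nonzero polynomial $p$, $$p(x_1,x_2)Y_W(u,x_1)Y_W(v,x_2)=p(x_1,x_2)\sum_{i}\iota_{x_2,x_1}(f_i(x_2,x_1))\,Y_W(v^{(i)},x_2)Y_W(u^{(i)},x_1).\qquad(*)$$ A *unitary quantum Yang–Baxter operator* on $V$ is a linear map $S(x_1,x_2):V\otimes V\to V\otimes V\otimes\mathbb C_*(x_1,x_2)$ with $S_{21}(x_2,x_1)S(x_1,x_2)=1$, where $S_{21}=\sigma S\sigma$ for the flip map $\sigma$ of $V\otimes V$, and, with coefficients in $\mathbb C_*(x_1,x_2,x_3)$, $S_{12}(x_1,x_2)S_{13}(x_1,x_3)S_{23}(x_2,x_3)=S_{23}(x_2,x_3)S_{13}(x_1,x_3)S_{12}(x_1,x_2)$.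 A *unitary rational quantum Yang–Baxter operator* on $V$ is a linear map $T(x):V\otimes V\to V\otimes V\otimes\mathbb C((x))$ with $T_{21}(x)T(-x)=1$ and, with coefficients in $\mathbb C_*(x,z)$, $T_{12}(x)T_{13}(x+z)T_{23}(z)=T_{23}(z)T_{13}(x+z)T_{12}(x)$. **Theorem.** Let $V$ be a nonlocal vertex algebra and let $(W,Y_W)$ be a pseudo-local quasi $V$-module such that the linear map $$\pi_3^W:V^{\otimes 3}\otimes\mathbb C((x_1))((x_2))((x_3))\to\mathrm{Hom}(W,W((x_1))((x_2))((x_3))),\quad v_1\otimes v_2\otimes v_3\otimes f\mapsto f\,Y_W(v_1,x_1)Y_W(v_2,x_2)Y_W(v_3,x_3)$$ is injective. Then there is a linear map $S(x_1,x_2):V\otimes V\to V\otimes V\otimes\mathbb C_*(x_1,x_2)$ such that, for all $u,v\in V$ and all finite families $(f_i,v^{(i)},u^{(i)})$, one has $S(x_2,x_1)(v\otimes u)=\sum_i v^{(i)}\otimes u^{(i)}\otimes f_i(x_2,x_1)$ if and only if $(*)$ holds for some nonzero polynomial $p$. Moreover: 1. $W$ is an $S$-quasi module, i.e. for all $u,v\in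 V$, $(*)$ holds for some nonzero polynomial $p$ with $\sum_i v^{(i)}\otimes u^{(i)}\otimes f_i(x_2,x_1)=S(x_2,x_1)(v\otimes u)$; and $S$ is the only linear map $V\otimes V\to V\otimes V\otimes\mathbb C_*(x_1,x_2)$ with this property. 2. $S$ is a unitary quantum Yang–Baxter operator on $V$. 3. $[1\otimes\mathcal D,S(x_1,x_2)]=-\frac{\partial}{\partial x_2}S(x_1,x_2)$. 4. Suppose that $U=\{Y_W(v,x)\mid v\in V\}$ is $\mathcal S$-local, i.e. for all $a(x),b(x)\in U$ there are finitely many $\psi_i\in\mathbb C((x))$ and $u_i(x),v_i(x)\in U$, and $k\ge 0$, with $$(x_1-x_2)^ka(x_1)b(x_2)=(x_1-x_2)^k\sum_i\iota_{x_2,x_1}(\psi_i(x_2-x_1))\,u_i(x_2)v_i(x_1).$$ Then there is a unitary rational quantum Yang–Baxter operator $T$ on $V$ with $S(x_1,x_2)=T(x_1-x_2)$. -/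

import Mathlib

open scoped TensorProduct

set_option maxSynthPendingDepth 3

/- `HahnSeries R` carries two (propositionally equal) `ℂ`-algebra structures in Mathlib; we use the
coefficientwise one throughout. -/
attribute [-instance] HahnSeries.powerSeriesAlgebra

noncomputable section

namespace QuasiVA

/-! ## The rings `ℂ_*(x₁,…,xₙ)` -/

/-- The nonzero polynomials in `x₁,…,xₙ`, viewed as formal power series. -/
abbrev nonzeroPolys (n : ℕ) : Submonoid (MvPowerSeries (Fin n) ℂ) :=
  (nonZeroDivisors (MvPolynomial (Fin n) ℂ)).map MvPolynomial.coeToMvPowerSeries.ringHom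

/-- `ℂ_*(x₁,…,xₙ)`: the localization of `ℂ[[x₁,…,xₙ]]` at the nonzero polynomials. -/
abbrev CStar (n : ℕ) : Type := Localization (nonzeroPolys n)

namespace CStar

/-- A polynomial as an element of `ℂ_*(x₁,…,xₙ)`. -/
def ofPoly {n : ℕ} (p : MvPolynomial (Fin n) ℂ) : CStar n :=
  algebraMap (MvPowerSeries (Fin n) ℂ) (CStar n) (p : MvPowerSeries (Fin n) ℂ)

theorem isUnit_ofPoly {n : ℕ} {p : MvPolynomial (Fin n) ℂ} (hp : p ≠ 0) : IsUnit (ofPoly p) :=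
  IsLocalization.map_units (CStar n)
    (⟨p, ⟨p, mem_nonZeroDivisors_of_ne_zero hp, rfl⟩⟩ : nonzeroPolys n)

/-- Universal property: an algebra homomorphism out of `ℂ[[x₁,…,xₙ]]` that makes all nonzero
polynomials invertible extends to `ℂ_*(x₁,…,xₙ)`. -/
def lift {n : ℕ} {A : Type} [CommRing A] [Algebra ℂ A] (φ : MvPowerSeries (Fin n) ℂ →ₐ[ℂ] A)
    (h : ∀ p : MvPolynomial (Fin n) ℂ, p ≠ 0 → IsUnit (φ (p : MvPowerSeries (Fin n) ℂ))) :
    CStar n →ₐ[ℂ] A :=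
  IsLocalization.liftAlgHom (M := nonzeroPolys n) (f := φ) (by
    rintro ⟨_, p, hp, rfl⟩
    exact h p (nonZeroDivisors.ne_zero hp))

theorem lift_algebraMap {n : ℕ} {A : Type} [CommRing A] [Algebra ℂ A]
    (φ : MvPowerSeries (Fin n) ℂ →ₐ[ℂ] A)
    (h : ∀ p : MvPolynomial (Fin n) ℂ, p ≠ 0 → IsUnit (φ (p : MvPowerSeries (Fin n) ℂ)))
    (f : MvPowerSeries (Fin n) ℂ) :
    lift φ h (algebraMap (MvPowerSeries (Fin n) ℂ) (CStar n) f) = φ f := by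
  simp [lift]

/-- Renaming of variables `f(x₁,…,xₘ) ↦ f(x_{e(1)},…,x_{e(m)})`, for injective `e`. -/
def rename {m n : ℕ} (e : Fin m ↪ Fin n) : CStar m →ₐ[ℂ] CStar n :=
  lift ((IsScalarTower.toAlgHom ℂ (MvPowerSeries (Fin n) ℂ) (CStar n)).comp
      (MvPowerSeries.rename (R := ℂ) e)) (by
    intro p hp
    have h : MvPolynomial.rename e p ≠ 0 := fun h0 =>
      hp (MvPolynomial.rename_injective e e.injective (by simpa using h0))
    simpa [ofPoly, MvPowerSeries.rename_coe] using isUnit_ofPoly h)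

/-- The injection `1 ↦ i, 2 ↦ j`. -/
def pair {n : ℕ} (i j : Fin n) (h : i ≠ j) : Fin 2 ↪ Fin n :=
  ⟨![i, j], by
    intro a b hab
    fin_cases a <;> fin_cases b <;> simp_all [eq_comm]⟩

@[simp] theorem pair_zero {n : ℕ} (i j : Fin n) (h : i ≠ j) : pair i j h 0 = i := rfl

@[simp] theorem pair_one {n : ℕ} (i j : Fin n) (h : i ≠ j) : pair i j h 1 = j := rfl

theorem algebraMap_complex_smul {n : ℕ} (c : ℂ) (f : MvPowerSeries (Fin n) ℂ) :
    algebraMap _ (CStar n) (c • f) = c • algebraMap _ (CStar n) f :=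
  (IsScalarTower.toAlgHom ℂ (MvPowerSeries (Fin n) ℂ) (CStar n)).toLinearMap.map_smul c f

/-- The partial derivative `∂/∂xᵢ` on `ℂ_*(x₁,…,xₙ)` as a ring homomorphism `f ↦ f + ε ∂ᵢf` to the
dual numbers. -/
def dualPderiv {n : ℕ} (i : Fin n) : CStar n →ₐ[ℂ] DualNumber (CStar n) :=
  lift (n := n)
    (AlgHom.ofLinearMap
      { toFun := fun f =>
          (TrivSqZeroExt.inl (algebraMap _ (CStar n) f) +
            TrivSqZeroExt.inr (algebraMap _ (CStar n) (MvPowerSeries.pderiv ℂ i f)) :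
              DualNumber (CStar n))
        map_add' := by
          intro f g
          ext <;> simp only [map_add, TrivSqZeroExt.fst_add, TrivSqZeroExt.snd_add,
            TrivSqZeroExt.fst_inl, TrivSqZeroExt.snd_inl, TrivSqZeroExt.fst_inr,
            TrivSqZeroExt.snd_inr] <;> ring
        map_smul' := by
          intro c f
          ext <;> simp only [Derivation.map_smul, algebraMap_complex_smul, TrivSqZeroExt.fst_add,
            TrivSqZeroExt.snd_add, TrivSqZeroExt.fst_inl, TrivSqZeroExt.snd_inl,
            TrivSqZeroExt.fst_inr, TrivSqZeroExt.snd_inr, TrivSqZeroExt.fst_smul,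
            TrivSqZeroExt.snd_smul, add_zero, zero_add, RingHom.id_apply] }
      (by ext <;> simp)
      (by
        intro f g
        ext <;> simp only [LinearMap.coe_mk, AddHom.coe_mk, map_mul, map_add, Derivation.leibniz,
          smul_eq_mul, TrivSqZeroExt.fst_add, TrivSqZeroExt.snd_add, TrivSqZeroExt.fst_inl,
          TrivSqZeroExt.snd_inl, TrivSqZeroExt.fst_inr, TrivSqZeroExt.snd_inr,
          TrivSqZeroExt.fst_mul, TrivSqZeroExt.snd_mul, MulOpposite.smul_eq_mul_unop,
          MulOpposite.unop_op, add_zero, zero_add]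
        ring))
    (by
      intro p hp
      rw [TrivSqZeroExt.isUnit_iff_isUnit_fst]
      simpa [ofPoly] using isUnit_ofPoly hp)

theorem fst_dualPderiv {n : ℕ} (i : Fin n) (f : CStar n) : (dualPderiv i f).fst = f := by
  have : (TrivSqZeroExt.fstHom (CStar n) (CStar n) (CStar n)).toRingHom.comp
      (dualPderiv i).toRingHom = RingHom.id _ := by
    apply IsLocalization.ringHom_ext (nonzeroPolys n)
    ext f
    simp [dualPderiv, lift_algebraMap]
  exact congrArg (fun φ : CStar n →+* CStar n => φ f) this

/-- The partial derivative `∂/∂xᵢ` on `ℂ_*(x₁,…,xₙ)`: the derivation extending the formal partial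
derivative of power series. -/
def pderiv {n : ℕ} (i : Fin n) : Derivation ℂ (CStar n) (CStar n) :=
  Derivation.mk'
    ({ toFun := fun f => (dualPderiv i f).snd
       map_add' := by intro f g; simp
       map_smul' := by intro c f; simp } : CStar n →ₗ[ℂ] CStar n)
    (by
      intro f g
      simp [fst_dualPderiv, mul_comm])

theorem pderiv_algebraMap {n : ℕ} (i : Fin n) (f : MvPowerSeries (Fin n) ℂ) :
    pderiv i (algebraMap _ (CStar n) f) = algebraMap _ (CStar n) (MvPowerSeries.pderiv ℂ i f) := by
  simp only [pderiv, dualPderiv, Derivation.coe_mk', LinearMap.coe_mk, AddHom.coe_mk,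
    lift_algebraMap, AlgHom.ofLinearMap_apply, TrivSqZeroExt.snd_add, TrivSqZeroExt.snd_inl,
    TrivSqZeroExt.snd_inr, zero_add]

end CStar

instance : IsScalarTower ℂ (PowerSeries ℂ) (LaurentSeries ℂ) :=
  IsScalarTower.of_algebraMap_eq fun c => by
    simp [LaurentSeries.coe_algebraMap, HahnSeries.algebraMap_apply]

/-- Universal property of `ℂ((x)) = ℂ[[x]][x⁻¹]`: an algebra homomorphism out of `ℂ[[x]]` that makes
`x` invertible extends to `ℂ((x))`. -/
def laurentLift {A : Type} [CommRing A] [Algebra ℂ A] (φ : PowerSeries ℂ →ₐ[ℂ] A)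
    (h : IsUnit (φ PowerSeries.X)) : LaurentSeries ℂ →ₐ[ℂ] A :=
  IsLocalization.liftAlgHom (M := Submonoid.powers (PowerSeries.X : PowerSeries ℂ)) (f := φ) (by
    rintro ⟨_, k, rfl⟩
    simpa using h.pow k)

/-- Substitution `f(x) ↦ f(ℓ(x₁,…,xₙ))` from `ℂ((x))` to `ℂ_*(x₁,…,xₙ)`, for a nonzero polynomial `ℓ`
without constant term. -/
def laurentSubst {n : ℕ} (l : MvPolynomial (Fin n) ℂ) (h0 : MvPolynomial.constantCoeff l = 0)
    (hl : l ≠ 0) : LaurentSeries ℂ →ₐ[ℂ] CStar n :=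
  laurentLift ((IsScalarTower.toAlgHom ℂ (MvPowerSeries (Fin n) ℂ) (CStar n)).comp
      (PowerSeries.substAlgHom (R := ℂ) (a := (l : MvPowerSeries (Fin n) ℂ))
        (PowerSeries.HasSubst.of_constantCoeff_zero (by
          rw [← MvPowerSeries.coeff_zero_eq_constantCoeff_apply, MvPolynomial.coeff_coe]
          exact h0))))
    (by
      have := CStar.isUnit_ofPoly hl
      rw [CStar.ofPoly] at this
      rw [AlgHom.comp_apply, PowerSeries.substAlgHom_X]
      exact this)

/-- `f(x) ↦ f(-x)` on `ℂ((x))`. -/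
def laurentNeg : LaurentSeries ℂ →ₐ[ℂ] LaurentSeries ℂ :=
  laurentLift ((HahnSeries.ofPowerSeriesAlg (Γ := ℤ) (R := ℂ) (A := ℂ)).comp
    (PowerSeries.rescaleAlgHom (-1 : ℂ))) (by
      have h : (HahnSeries.ofPowerSeriesAlg (Γ := ℤ) (R := ℂ) (A := ℂ)).comp
          (PowerSeries.rescaleAlgHom (-1 : ℂ)) PowerSeries.X ≠ 0 := by
        have hX : PowerSeries.rescaleAlgHom (-1 : ℂ) PowerSeries.X = -PowerSeries.X := by
          rw [← PowerSeries.evalNegHom_X]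
          exact DFunLike.congr_fun (PowerSeries.coe_rescaleAlgHom (-1 : ℂ)) PowerSeries.X
        rw [AlgHom.comp_apply, hX, map_neg]
        refine neg_ne_zero.mpr fun h0 => PowerSeries.X_ne_zero (R := ℂ)
          (HahnSeries.ofPowerSeries_injective (Γ := ℤ) (R := ℂ) ?_)
        rw [map_zero]
        exact h0
      exact h.isUnit)

theorem X_ne_zero {n : ℕ} (i : Fin n) : (MvPolynomial.X i : MvPolynomial (Fin n) ℂ) ≠ 0 :=
  MvPolynomial.X_ne_zero i

theorem X_add_X_ne_zero :
    (MvPolynomial.X 0 + MvPolynomial.X 1 : MvPolynomial (Fin 2) ℂ) ≠ 0 := by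
  intro h
  have := congrArg (MvPolynomial.eval ![(1 : ℂ), 0]) h
  simp at this

theorem X_sub_X_ne_zero :
    (MvPolynomial.X 0 - MvPolynomial.X 1 : MvPolynomial (Fin 2) ℂ) ≠ 0 := by
  intro h
  have := congrArg (MvPolynomial.eval ![(1 : ℂ), 0]) h
  simp at this

/-- `f(x) ↦ f(xᵢ)`. -/
def laurentX {n : ℕ} (i : Fin n) : LaurentSeries ℂ →ₐ[ℂ] CStar n :=
  laurentSubst (MvPolynomial.X i) (by simp) (X_ne_zero i)

/-- `f(x) ↦ f(x₁ + x₂)`. -/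
def laurentAdd : LaurentSeries ℂ →ₐ[ℂ] CStar 2 :=
  laurentSubst (MvPolynomial.X 0 + MvPolynomial.X 1) (by simp) X_add_X_ne_zero

/-- `f(x) ↦ f(x₁ - x₂)`. -/
def laurentSub : LaurentSeries ℂ →ₐ[ℂ] CStar 2 :=
  laurentSubst (MvPolynomial.X 0 - MvPolynomial.X 1) (by simp) X_sub_X_ne_zero

/-! ## Iterated Laurent series and the embedding `ι` -/

/-- `ℂ((x₁))`. -/
abbrev L1 : Type := LaurentSeries ℂ

/-- `ℂ((x₁))((x₂))`: the outer series is in `x₂`, its coefficients are series in `x₁`. -/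
abbrev L2 : Type := LaurentSeries L1

/-- `ℂ((x₁))((x₂))((x₃))`. -/
abbrev L3 : Type := LaurentSeries L2

/-- The inclusion `ℂ[[x₁]] → ℂ((x₁))`. -/
def expand1 : MvPowerSeries (Fin 1) ℂ →ₐ[ℂ] L1 :=
  (HahnSeries.ofPowerSeriesAlg (Γ := ℤ) (R := ℂ) (A := ℂ)).comp
    ((PowerSeries.mapAlgHom (MvPowerSeries.isEmptyEquiv (Fin 0) ℂ).toAlgHom).comp
      (MvPowerSeries.finSuccEquiv ℂ 0).toAlgHom)

/-- The inclusion `ℂ[[x₁,x₂]] → ℂ((x₁))((x₂))`. -/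
def expand2 : MvPowerSeries (Fin 2) ℂ →ₐ[ℂ] L2 :=
  (HahnSeries.ofPowerSeriesAlg (Γ := ℤ) (R := ℂ) (A := L1)).comp
    ((PowerSeries.mapAlgHom expand1).comp
      ((MvPowerSeries.finSuccEquiv ℂ 1).toAlgHom.comp
        (MvPowerSeries.rename (R := ℂ) (CStar.pair (1 : Fin 2) 0 (by decide)))))

theorem expand1_injective : Function.Injective expand1 := by
  refine (HahnSeries.ofPowerSeries_injective (Γ := ℤ) (R := ℂ)).comp ?_
  exact (PowerSeries.map_injective _
    (MvPowerSeries.isEmptyEquiv (Fin 0) ℂ).injective).comp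
      (MvPowerSeries.finSuccEquiv ℂ 0).injective

theorem expand2_injective : Function.Injective expand2 := by
  refine (HahnSeries.ofPowerSeries_injective (Γ := ℤ) (R := L1)).comp ?_
  exact (PowerSeries.map_injective _ expand1_injective).comp
    ((MvPowerSeries.finSuccEquiv ℂ 1).injective.comp (MvPowerSeries.rename_injective _))

/-- The coefficient of `x₁^i x₂^j` is unchanged by the inclusion. -/
theorem expand2_coeff (f : MvPowerSeries (Fin 2) ℂ) (i j : ℕ) :
    ((expand2 f).coeff j).coeff i =
      MvPowerSeries.coeff (Finsupp.single 0 i + Finsupp.single 1 j) f := by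
  have h1 : ∀ g : MvPowerSeries (Fin 1) ℂ,
      (expand1 g).coeff i = MvPowerSeries.coeff (Finsupp.cons i 0) g := by
    intro g
    rw [← MvPowerSeries.coeff_coeff_finSuccEquiv]
    exact HahnSeries.ofPowerSeries_apply_coeff _ _
  have h2 : (expand2 f).coeff j = expand1 (PowerSeries.coeff j (MvPowerSeries.finSuccEquiv ℂ 1
      (MvPowerSeries.rename (CStar.pair (1 : Fin 2) 0 (by decide)) f))) :=
    HahnSeries.ofPowerSeries_apply_coeff _ _
  rw [h2, h1, MvPowerSeries.coeff_coeff_finSuccEquiv,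
    ← MvPowerSeries.coeff_embDomain_rename (CStar.pair (1 : Fin 2) 0 (by decide)) f]
  suffices h3 : (Finsupp.cons j (Finsupp.cons i 0) : Fin 2 →₀ ℕ) =
      Finsupp.embDomain (CStar.pair (1 : Fin 2) 0 (by decide))
        (Finsupp.single 0 i + Finsupp.single 1 j) by
    rw [← h3]
  rw [Finsupp.embDomain_add, Finsupp.embDomain_single, Finsupp.embDomain_single]
  ext k
  fin_cases k
  · simp
  · change (Finsupp.cons j (Finsupp.cons i 0)) (Fin.succ 0) = _
    rw [Finsupp.cons_succ]
    simp

/-- The embedding `ι_{x₁,x₂} : ℂ_*(x₁,x₂) → ℂ((x₁))((x₂))`. -/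
def iota : CStar 2 →ₐ[ℂ] L2 :=
  CStar.lift expand2 (by
    intro p hp
    have h : expand2 (p : MvPowerSeries (Fin 2) ℂ) ≠ 0 := fun h => hp
      (MvPolynomial.coe_injective _ _ (expand2_injective (by simpa using h)))
    exact h.isUnit)

/-! ## Operators on tensor products with coefficients -/

section Operators

variable {V : Type*} [AddCommGroup V] [Module ℂ V]

/-- The `A`-linear extension of an operator `R : M → A ⊗ M` to `A ⊗ M`; composition of operators with
coefficients in `A` is composition of these extensions. -/
def ext (A : Type) [CommRing A] [Algebra ℂ A] {M : Type*} [AddCommGroup M] [Module ℂ M]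
    (R : M →ₗ[ℂ] A ⊗[ℂ] M) : A ⊗[ℂ] M →ₗ[A] A ⊗[ℂ] M :=
  LinearMap.liftBaseChange A R

/-- Change of coefficients of an operator along `φ : A → B`. -/
def mapCoeff {A B : Type} [CommRing A] [Algebra ℂ A] [CommRing B] [Algebra ℂ B] (φ : A →ₐ[ℂ] B)
    {M : Type*} [AddCommGroup M] [Module ℂ M] (R : M →ₗ[ℂ] A ⊗[ℂ] M) : M →ₗ[ℂ] B ⊗[ℂ] M :=
  LinearMap.rTensor M φ.toLinearMap ∘ₗ R

variable {A : Type} [CommRing A] [Algebra ℂ A]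

/-- `R₂₁ = σ R σ`, where `σ` is the flip map of `V ⊗ V`. -/
def op21 (R : V ⊗[ℂ] V →ₗ[ℂ] A ⊗[ℂ] (V ⊗[ℂ] V)) : V ⊗[ℂ] V →ₗ[ℂ] A ⊗[ℂ] (V ⊗[ℂ] V) :=
  LinearMap.lTensor A (TensorProduct.comm ℂ V V).toLinearMap ∘ₗ R ∘ₗ
    (TensorProduct.comm ℂ V V).toLinearMap

/-- `R₂₃`: the operator `R` on the second and third factors of `V ⊗ V ⊗ V`. -/
def op23 (R : V ⊗[ℂ] V →ₗ[ℂ] A ⊗[ℂ] (V ⊗[ℂ] V)) :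
    V ⊗[ℂ] (V ⊗[ℂ] V) →ₗ[ℂ] A ⊗[ℂ] (V ⊗[ℂ] (V ⊗[ℂ] V)) :=
  (TensorProduct.leftComm ℂ V A (V ⊗[ℂ] V)).toLinearMap ∘ₗ LinearMap.lTensor V R

/-- `R₁₂`: the operator `R` on the first and second factors of `V ⊗ V ⊗ V`. -/
def op12 (R : V ⊗[ℂ] V →ₗ[ℂ] A ⊗[ℂ] (V ⊗[ℂ] V)) :
    V ⊗[ℂ] (V ⊗[ℂ] V) →ₗ[ℂ] A ⊗[ℂ] (V ⊗[ℂ] (V ⊗[ℂ] V)) :=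
  LinearMap.lTensor A (TensorProduct.assoc ℂ V V V).toLinearMap ∘ₗ
    (TensorProduct.assoc ℂ A (V ⊗[ℂ] V) V).toLinearMap ∘ₗ
    LinearMap.rTensor V R ∘ₗ (TensorProduct.assoc ℂ V V V).symm.toLinearMap

/-- `R₁₃ = σ₂₃ R₁₂ σ₂₃`: the operator `R` on the first and third factors of `V ⊗ V ⊗ V`. -/
def op13 (R : V ⊗[ℂ] V →ₗ[ℂ] A ⊗[ℂ] (V ⊗[ℂ] V)) :
    V ⊗[ℂ] (V ⊗[ℂ] V) →ₗ[ℂ] A ⊗[ℂ] (V ⊗[ℂ] (V ⊗[ℂ] V)) :=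
  LinearMap.lTensor A (LinearMap.lTensor V (TensorProduct.comm ℂ V V).toLinearMap) ∘ₗ
    op12 R ∘ₗ LinearMap.lTensor V (TensorProduct.comm ℂ V V).toLinearMap

/-- Unitary quantum Yang–Baxter operator with two spectral parameters on `V`:
`S₂₁(x₂,x₁) S(x₁,x₂) = 1` and
`S₁₂(x₁,x₂) S₁₃(x₁,x₃) S₂₃(x₂,x₃) = S₂₃(x₂,x₃) S₁₃(x₁,x₃) S₁₂(x₁,x₂)`. -/
structure IsUnitaryQYB (S : V ⊗[ℂ] V →ₗ[ℂ] CStar 2 ⊗[ℂ] (V ⊗[ℂ] V)) : Prop where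
  unitary :
    ext (CStar 2) (op21 (mapCoeff (CStar.rename (CStar.pair 1 0 (by decide))) S)) ∘ₗ
      ext (CStar 2) S = LinearMap.id
  yangBaxter :
    let S₁₂ := ext (CStar 3) (op12 (mapCoeff (CStar.rename (CStar.pair 0 1 (by decide))) S))
    let S₁₃ := ext (CStar 3) (op13 (mapCoeff (CStar.rename (CStar.pair 0 2 (by decide))) S))
    let S₂₃ := ext (CStar 3) (op23 (mapCoeff (CStar.rename (CStar.pair 1 2 (by decide))) S))
    S₁₂ ∘ₗ S₁₃ ∘ₗ S₂₃ = S₂₃ ∘ₗ S₁₃ ∘ₗ S₁₂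

/-- Unitary rational quantum Yang–Baxter operator on `V`: `T₂₁(x) T(-x) = 1` and
`T₁₂(x) T₁₃(x+z) T₂₃(z) = T₂₃(z) T₁₃(x+z) T₁₂(x)`, where `f(x)`, `f(x+z)`, `f(z)` for `f ∈ ℂ((x))` are
taken in `ℂ_*(x,z)`. -/
structure IsUnitaryRationalQYB (T : V ⊗[ℂ] V →ₗ[ℂ] LaurentSeries ℂ ⊗[ℂ] (V ⊗[ℂ] V)) : Prop where
  unitary :
    ext (LaurentSeries ℂ) (op21 T) ∘ₗ ext (LaurentSeries ℂ) (mapCoeff laurentNeg T) = LinearMap.id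
  yangBaxter :
    let T₁₂ := ext (CStar 2) (op12 (mapCoeff (laurentX 0) T))
    let T₁₃ := ext (CStar 2) (op13 (mapCoeff laurentAdd T))
    let T₂₃ := ext (CStar 2) (op23 (mapCoeff (laurentX 1) T))
    T₁₂ ∘ₗ T₁₃ ∘ₗ T₂₃ = T₂₃ ∘ₗ T₁₃ ∘ₗ T₁₂

end Operators

/-! ## Iterated Laurent series with coefficients in a vector space -/

/-- `M((x))` as a module over `R((x)) = LaurentSeries R`, for an `R`-module `M`. (The order on `ℤ` is
spelled as in `LaurentSeries`.) -/
abbrev LaurentModule (R M : Type*) [Zero M] [SMul R M] : Type _ :=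
  @HahnModule ℤ R M (@SemilatticeInf.toPartialOrder ℤ (@Lattice.toSemilatticeInf ℤ instLatticeInt)) _ _

section Fields

variable (W : Type*) [AddCommGroup W] [Module ℂ W]

/-- `W((x₁))`, a module over `ℂ((x₁))`. -/
abbrev E1 : Type _ := LaurentModule ℂ W

/-- `W((x₁))((x₂))`, a module over `ℂ((x₁))((x₂))`: the outer series is in `x₂`, its coefficients are
series in `x₁`. -/
abbrev E2 : Type _ := LaurentModule L1 (E1 W)

/-- `W((x₁))((x₂))((x₃))`, a module over `ℂ((x₁))((x₂))((x₃))`. -/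
abbrev E3 : Type _ := LaurentModule L2 (E2 W)

/-- The coefficientwise `ℂ`-vector space structure of `W((x₁))((x₂))`. -/
instance instModuleComplexE2 : Module ℂ (E2 W) := inferInstanceAs (Module ℂ (LaurentSeries (E1 W)))

/-- The coefficientwise `ℂ`-vector space structure of `W((x₁))((x₂))((x₃))`. -/
instance instModuleComplexE3 : Module ℂ (E3 W) := inferInstanceAs (Module ℂ (LaurentSeries (E2 W)))

instance instIsScalarTowerE2 : IsScalarTower ℂ L2 (E2 W) where
  smul_assoc c f x := by
    rw [← algebraMap_smul L1 c f, smul_assoc]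
    refine HahnModule.ext _ _ (funext fun n => ?_)
    exact algebraMap_smul L1 c (((HahnModule.of L1).symm (f • x)).coeff n)

instance instIsScalarTowerE3 : IsScalarTower ℂ L3 (E3 W) where
  smul_assoc c f x := by
    rw [← algebraMap_smul L2 c f, smul_assoc]
    refine HahnModule.ext _ _ (funext fun n => ?_)
    exact algebraMap_smul L2 c (((HahnModule.of L2).symm (f • x)).coeff n)

instance instSMulCommClassE3 : SMulCommClass ℂ L3 (E3 W) :=
  IsScalarTower.to_smulCommClass (R := ℂ) (A := L3) (M := E3 W)

instance instSMulCommClassE3' : SMulCommClass L3 ℂ (E3 W) := SMulCommClass.symm _ _ _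

variable {W}

/-- The coefficient of `xⁿ`, where `x` is the outermost variable. -/
def coeff {R M : Type*} [SMul R M] [Zero M] (F : LaurentModule R M) (n : ℤ) : M :=
  ((HahnModule.of R).symm F).coeff n

/-- The coefficient of `x₁^i x₂^j` of `F ∈ W((x₁))((x₂))`. -/
def coeff₂ (F : E2 W) (i j : ℤ) : W := coeff (coeff F j) i

/-- The space `ℰ(W) = Hom(W, W((x)))`. -/
abbrev Fld (W : Type*) [AddCommGroup W] [Module ℂ W] : Type _ := W →ₗ[ℂ] E1 W

/-- The product `a(x₁)b(x₂) ∈ Hom(W, W((x₁))((x₂)))`: here `a(x₁)` is applied to the coefficients of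
the powers of `x₂`. More generally, `a(x₁) : U → W((x₁))` and `b(x₂) ∈ U((x₂))`. -/
def apply₂ {U : Type*} [AddCommGroup U] [Module ℂ U] (a : U →ₗ[ℂ] E1 W) : E1 U →ₗ[ℂ] E2 W where
  toFun F := HahnModule.of L1 (((HahnModule.of ℂ).symm F).map a)
  map_add' F G := by
    refine HahnModule.ext _ _ (funext fun n => ?_)
    exact a.map_add _ _
  map_smul' c F := by
    refine HahnModule.ext _ _ (funext fun n => ?_)
    exact a.map_smul _ _

/-- The product `a(x₁,x₂)b(x₃)`, where `a(x₁,x₂) : U → W((x₁))((x₂))` and `b(x₃) ∈ U((x₃))`. -/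
def apply₃ {U : Type*} [AddCommGroup U] [Module ℂ U] (a : U →ₗ[ℂ] E2 W) : E1 U →ₗ[ℂ] E3 W where
  toFun F := HahnModule.of L2 (((HahnModule.of ℂ).symm F).map a)
  map_add' F G := by
    refine HahnModule.ext _ _ (funext fun n => ?_)
    exact a.map_add _ _
  map_smul' c F := by
    refine HahnModule.ext _ _ (funext fun n => ?_)
    exact a.map_smul _ _

theorem apply₂_add {U : Type*} [AddCommGroup U] [Module ℂ U] (a b : U →ₗ[ℂ] E1 W) :
    apply₂ (a + b) = apply₂ a + apply₂ b := rfl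

theorem apply₂_smul {U : Type*} [AddCommGroup U] [Module ℂ U] (c : ℂ) (a : U →ₗ[ℂ] E1 W) :
    apply₂ (c • a) = c • apply₂ a := rfl

theorem apply₃_add {U : Type*} [AddCommGroup U] [Module ℂ U] (a b : U →ₗ[ℂ] E2 W) :
    apply₃ (a + b) = apply₃ a + apply₃ b := rfl

theorem apply₃_smul {U : Type*} [AddCommGroup U] [Module ℂ U] (c : ℂ) (a : U →ₗ[ℂ] E2 W) :
    apply₃ (c • a) = c • apply₃ a := rfl

/-- `p(x₁,x₂) F(x₁,x₂) = p(x₁,x₂) G(x₁,x₂)`, as formal series in `x₁^{±1}, x₂^{±1}`, for a polynomial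
`p`, a series `F ∈ W((x₁))((x₂))` and a series `G ∈ W((x₂))((x₁))`. (For the type `E2 W` of `G`, the
variable `x₂` is the first, inner one.) -/
def EqAfterMul (p : MvPolynomial (Fin 2) ℂ) (F G : E2 W) : Prop :=
  ∀ i j : ℤ,
    coeff₂ (iota (CStar.ofPoly p) • F) i j =
      coeff₂ (iota (CStar.ofPoly (MvPolynomial.rename (Equiv.swap 0 1) p)) • G) j i

/-- The coefficient of `x₀^a x₂^b` in `F(x₀+x₂, x₂)`, for `F(x₁,x₂) ∈ W((x₁))((x₂))`; the powers of `x₀ + x₂`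
are expanded in nonnegative powers of `x₂`. The sum is finite. -/
def substCoeff (F : E2 W) (b a : ℤ) : W :=
  ∑ᶠ i : ℕ, Ring.choose (a + i) i • coeff₂ F (a + i) (b - i)

theorem exists_coeff_eq_zero {R M : Type*} [SMul R M] [Zero M] (F : LaurentModule R M) :
    ∃ N : ℤ, ∀ n < N, coeff F n = 0 :=
  ⟨((HahnModule.of R).symm F).order, fun _ hn => HahnSeries.coeff_eq_zero_of_lt_order hn⟩

theorem exists_coeff₂_eq_zero (F : E2 W) :
    ∃ N : ℤ, ∀ i, ∀ j < N, coeff₂ F i j = 0 := by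
  obtain ⟨N, hN⟩ := exists_coeff_eq_zero F
  refine ⟨N, fun i j hj => ?_⟩
  rw [coeff₂, hN j hj]
  rfl

theorem substCoeff_bddBelow (F : E2 W) (b : ℤ) :
    BddBelow (Function.support (substCoeff F b)) := by
  obtain ⟨N, hN⟩ := exists_coeff₂_eq_zero F
  choose m hm using fun j : ℤ => exists_coeff_eq_zero (coeff F j)
  obtain ⟨K, hK⟩ := ((Set.finite_Icc N b).image fun j => m j - (b - j)).bddBelow
  refine ⟨K, fun a ha => not_lt.mp fun hlt => ha ?_⟩
  refine finsum_eq_zero_of_forall_eq_zero fun i => ?_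
  rcases lt_or_ge (b - (i : ℤ)) N with h | h
  · rw [hN _ _ h, smul_zero]
  · have h1 : K ≤ m (b - i) - (b - (b - i)) :=
      hK ⟨b - i, ⟨h, by omega⟩, rfl⟩
    rw [coeff₂, hm (b - i) (a + i) (by omega), smul_zero]

theorem substCoeff_bddBelow' (F : E2 W) :
    BddBelow (Function.support fun b : ℤ =>
      (HahnModule.of ℂ (HahnSeries.ofSuppBddBelow _ (substCoeff_bddBelow F b)) : E1 W)) := by
  obtain ⟨N, hN⟩ := exists_coeff₂_eq_zero F
  refine ⟨N, fun b hb => not_lt.mp fun hlt => hb ?_⟩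
  refine HahnModule.ext _ _ (funext fun a => ?_)
  change substCoeff F b a = 0
  refine finsum_eq_zero_of_forall_eq_zero fun i => ?_
  rw [hN _ _ (by omega), smul_zero]

/-- The substitution `F(x₁,x₂) ↦ F(x₀+x₂, x₂)` from `W((x₁))((x₂))` to `W((x₀))((x₂))`. -/
def subst (F : E2 W) : E2 W :=
  HahnModule.of L1 (HahnSeries.ofSuppBddBelow _ (substCoeff_bddBelow' F))

end Fields

/-! ## Nonlocal vertex algebras and quasi modules -/

/-- A nonlocal vertex algebra structure on the vector space `V`. -/
structure NonlocalVertexAlgebra (V : Type*) [AddCommGroup V] [Module ℂ V] where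
  /-- The vertex operator map `v ↦ Y(v,x)`. -/
  Y : V →ₗ[ℂ] Fld V
  /-- The vacuum vector. -/
  vac : V
  /-- `Y(1,x)v = v`. -/
  Y_vac : ∀ v, Y vac v = HahnModule.of ℂ (HahnSeries.single 0 v)
  /-- `Y(v,x)1 ∈ V[[x]]`. -/
  creation : ∀ v, ∀ n < 0, coeff (Y v vac) n = 0
  /-- `Y(v,x)1` has constant term `v`. -/
  creation_zero : ∀ v, coeff (Y v vac) 0 = v
  /-- `(x₀+x₂)^l Y(u,x₀+x₂)Y(v,x₂)w = (x₀+x₂)^l Y(Y(u,x₀)v,x₂)w`. -/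
  weak_assoc : ∀ u v w, ∃ l : ℕ,
    EqAfterMul ((MvPolynomial.X 0 + MvPolynomial.X 1) ^ l)
      (subst (apply₂ (Y u) (Y v w))) (apply₂ (Y.flip w) (Y u v))

/-- The operator `𝒟 v = v_{-2} 1`, the coefficient of `x` in `Y(v,x)1`. -/
def NonlocalVertexAlgebra.D {V : Type*} [AddCommGroup V] [Module ℂ V]
    (A : NonlocalVertexAlgebra V) : V →ₗ[ℂ] V where
  toFun v := coeff (A.Y v A.vac) 1
  map_add' u v := by
    rw [map_add]
    rfl
  map_smul' c v := by
    rw [map_smul]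
    rfl

/-- A quasi module structure on the vector space `W`, for a nonlocal vertex algebra `V`. -/
structure QuasiModule {V : Type*} [AddCommGroup V] [Module ℂ V] (A : NonlocalVertexAlgebra V)
    (W : Type*) [AddCommGroup W] [Module ℂ W] where
  /-- The vertex operator map `v ↦ Y_W(v,x)`. -/
  Y : V →ₗ[ℂ] Fld W
  /-- `Y_W(1,x) = 1_W`. -/
  Y_vac : ∀ w, Y A.vac w = HahnModule.of ℂ (HahnSeries.single 0 w)
  /-- `f(x₀+x₂,x₂) Y_W(u,x₀+x₂)Y_W(v,x₂)w = f(x₀+x₂,x₂) Y_W(Y(u,x₀)v,x₂)w` for some polynomial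
  `f(x₁,x₂) ≠ 0`. -/
  quasi_assoc : ∀ u v w, ∃ f : MvPolynomial (Fin 2) ℂ, f ≠ 0 ∧
    EqAfterMul (MvPolynomial.aeval ![MvPolynomial.X 0 + MvPolynomial.X 1, MvPolynomial.X 1] f)
      (subst (apply₂ (Y u) (Y v w))) (apply₂ (Y.flip w) (A.Y u v))

/-- A set `U` of fields on `W` is `𝒮`-local if for all `a, b ∈ U` there are `ψᵢ ∈ ℂ((x))`,
`uᵢ, vᵢ ∈ U` and `k ≥ 0` with
`(x₁-x₂)^k a(x₁)b(x₂) = (x₁-x₂)^k ∑ᵢ ι_{x₂,x₁}(ψᵢ(x₂-x₁)) uᵢ(x₂)vᵢ(x₁)`. -/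
def IsSLocal {W : Type*} [AddCommGroup W] [Module ℂ W] (U : Set (Fld W)) : Prop :=
  ∀ a ∈ U, ∀ b ∈ U, ∃ (r : ℕ) (ψ : Fin r → LaurentSeries ℂ) (u v : Fin r → Fld W) (k : ℕ),
    (∀ i, u i ∈ U ∧ v i ∈ U) ∧
    ∀ w, EqAfterMul ((MvPolynomial.X 0 - MvPolynomial.X 1) ^ k) (apply₂ a (b w))
      (∑ i, iota (laurentSub (ψ i)) • apply₂ (u i) (v i w))

namespace QuasiModule

variable {V W : Type*} [AddCommGroup V] [Module ℂ V] [AddCommGroup W] [Module ℂ W]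
  {A : NonlocalVertexAlgebra V} (M : QuasiModule A W)

/-- The pseudo-locality relation
`p(x₁,x₂) Y_W(u,x₁)Y_W(v,x₂) = p(x₁,x₂) ∑ᵢ ι_{x₂,x₁}(fᵢ(x₂,x₁)) Y_W(vᵢ,x₂)Y_W(uᵢ,x₁)`
for some nonzero polynomial `p`, where `fᵢ(x₁,x₂) ∈ ℂ_*(x₁,x₂)`. -/
def PseudoLocalRel (u v : V) {n : ℕ} (f : Fin n → CStar 2) (v' u' : Fin n → V) : Prop :=
  ∃ p : MvPolynomial (Fin 2) ℂ, p ≠ 0 ∧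
    ∀ w, EqAfterMul p (apply₂ (M.Y u) (M.Y v w))
      (∑ i, iota (f i) • apply₂ (M.Y (v' i)) (M.Y (u' i) w))

/-- The quasi module is pseudo-local. -/
def IsPseudoLocal : Prop :=
  ∀ u v : V, ∃ (n : ℕ) (f : Fin n → CStar 2) (v' u' : Fin n → V), M.PseudoLocalRel u v f v' u'

/-- The quasi module is an `S`-quasi module, for the operator `S(x₁,x₂)`: the pseudo-locality relation
holds for `u, v` with `S(x₂,x₁)(v ⊗ u) = ∑ᵢ vᵢ ⊗ uᵢ ⊗ fᵢ(x₂,x₁)`. -/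
def IsSQuasiModule (S : V ⊗[ℂ] V →ₗ[ℂ] CStar 2 ⊗[ℂ] (V ⊗[ℂ] V)) : Prop :=
  ∀ u v : V, ∃ (n : ℕ) (f : Fin n → CStar 2) (v' u' : Fin n → V),
    S (v ⊗ₜ u) = ∑ i, f i ⊗ₜ (v' i ⊗ₜ u' i) ∧ M.PseudoLocalRel u v f v' u'

/-- `v ⊗ w ↦ Y_W(u,x₁)Y_W(v,x₂)Y_W(w,x₃)`. -/
def Y₃Aux (u : V) : V ⊗[ℂ] V →ₗ[ℂ] (W →ₗ[ℂ] E3 W) :=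
  TensorProduct.lift <| LinearMap.mk₂ ℂ
    (fun v w => apply₃ (apply₂ (M.Y u) ∘ₗ M.Y v) ∘ₗ M.Y w)
    (fun _ _ _ => by simp only [map_add, LinearMap.comp_add, apply₃_add, LinearMap.add_comp])
    (fun _ _ _ => by simp only [map_smul, LinearMap.comp_smul, apply₃_smul, LinearMap.smul_comp])
    (fun _ _ _ => by simp only [map_add, LinearMap.comp_add])
    (fun _ _ _ => by simp only [map_smul, LinearMap.comp_smul])

/-- `u ⊗ v ⊗ w ↦ Y_W(u,x₁)Y_W(v,x₂)Y_W(w,x₃)`. -/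
def Y₃ : V ⊗[ℂ] (V ⊗[ℂ] V) →ₗ[ℂ] (W →ₗ[ℂ] E3 W) :=
  TensorProduct.lift
    { toFun := M.Y₃Aux
      map_add' := fun u u' => TensorProduct.ext' fun v w => by
        simp only [Y₃Aux, TensorProduct.lift.tmul, LinearMap.mk₂_apply, LinearMap.add_apply, map_add,
          apply₂_add, LinearMap.add_comp, apply₃_add]
      map_smul' := fun c u => TensorProduct.ext' fun v w => by
        simp only [Y₃Aux, TensorProduct.lift.tmul, LinearMap.mk₂_apply, LinearMap.smul_apply,
          map_smul, apply₂_smul, LinearMap.smul_comp, apply₃_smul, RingHom.id_apply] }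

/-- The linear map `π₃ : V^{⊗3} ⊗ ℂ((x₁))((x₂))((x₃)) → Hom(W, W((x₁))((x₂))((x₃)))`,
`u ⊗ v ⊗ w ⊗ f ↦ f(x₁,x₂,x₃) Y_W(u,x₁)Y_W(v,x₂)Y_W(w,x₃)`. -/
def pi₃ : L3 ⊗[ℂ] (V ⊗[ℂ] (V ⊗[ℂ] V)) →ₗ[L3] (W →ₗ[ℂ] E3 W) :=
  LinearMap.liftBaseChange L3 M.Y₃

end QuasiModule

end QuasiVA
end

noncomputable section

namespace QuasiVA

open Filter

/-! ## Coefficients of products with power series -/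

section Coefficients

/-! Call t and s in V ⊗ V ⊗ ℂ_*(x₁,x₂) related (`Rel₂`) when the products of vertex operators they
define, with t taken in the order x₁, x₂ and s in the order x₂, x₁, agree after multiplication by
one nonzero polynomial that serves all w ∈ W. Pseudo-locality says that every 1 ⊗ u ⊗ v is related
to some s.

The point is that t determines s (`Rel₂.unique`). If s and s' are both related to t, a nonzero
polynomial annihilates the difference of their products; this difference lies in a vector space over
the field ℂ((x₁))((x₂)), so the products coincide. The map from tensors to products is injective,
because tensoring with the vacuum on the right embeds it into the three-factor situation, where
`pi₃` is injective. So S is well defined and linear, and each further claim amounts to exhibiting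
two elements related to the same one; `Rel₃` is the version for three factors and any permutation of
the variables.

Unitarity: exchanging the two factors twice returns to the start. Yang–Baxter: reversing three
factors by the two reduced words of the longest permutation gives the same result (`isUnitaryQYB`).
Derivative formula: weak associativity with the vacuum gives Y_W(𝒟v,x) = d/dx Y_W(v,x)
(`coeff_Y_D`); applying x₁∂/∂x₁ to the relation for u, v must give x₁ times the relation for 𝒟u, v
(`commutator_D`). Rational case: an 𝒮-locality relation is a pseudo-locality relation with
coefficients in x₁ - x₂, so S has values in the image of the injective map `laurentSub`, and the
equations for T hold because they hold after injective substitutions.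

The technical obstacle is that W((x₁))((x₂)) and W((x₂))((x₁)) are different modules, so the two
sides can only be compared coefficient by coefficient. A coefficient of g • F, with g a power
series, is a finite sum and equals `boxSum N g` for all large N. The cube of side N is invariant
under permuting the variables, which makes multiplication compatible with changing their order
(`Expansion.Eqv.smul`). -/

theorem coeff_add {R M : Type*} [CommRing R] [AddCommGroup M] [Module R M]
    (F G : LaurentModule R M) (n : ℤ) : coeff (F + G) n = coeff F n + coeff G n := rfl

theorem coeff_ext {R M : Type*} [CommRing R] [AddCommGroup M] [Module R M]
    {F G : LaurentModule R M} (h : ∀ n, coeff F n = coeff G n) : F = G :=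
  HahnModule.ext _ _ (funext h)

theorem eventually_coeff_sub_eq_zero {R M : Type*} [CommRing R] [AddCommGroup M] [Module R M]
    (F : LaurentModule R M) (n : ℤ) : ∀ᶠ N : ℕ in atTop, ∀ k ≥ N, coeff F (n - k) = 0 := by
  obtain ⟨B, hB⟩ := exists_coeff_eq_zero F
  filter_upwards [eventually_ge_atTop ((n - B).toNat + 1)] with N hN k hk
  exact hB _ (by omega)

/-- The sum is finite because F is bounded below. Stating it for all large N, not for one explicit
bound, lets finitely many such formulas share a common N later. -/
theorem eventually_coeff_ofPowerSeries_smul {R M : Type*} [CommRing R] [AddCommGroup M] [Module R M]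
    (h : PowerSeries R) (F : LaurentModule R M) (n : ℤ) :
    ∀ᶠ N : ℕ in atTop, coeff ((HahnSeries.ofPowerSeries ℤ R h : LaurentSeries R) • F) n =
      ∑ k ∈ Finset.range N, PowerSeries.coeff k h • coeff F (n - k) := by
  filter_upwards [eventually_coeff_sub_eq_zero F n] with N hN
  rw [coeff, HahnModule.coeff_smul]
  have hs : ∀ i : ℤ, (HahnSeries.ofPowerSeries ℤ R h).coeff i ≠ 0 → 0 ≤ i := by
    intro i hi
    by_contra hneg
    refine hi (HahnSeries.embDomain_of_notMem_range ?_)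
    rintro ⟨k, hk⟩
    simp at hk
    omega
  refine Finset.sum_of_injOn (fun ij => ij.1.toNat) ?_ ?_ ?_ ?_
  · rintro ⟨a, b⟩ hab ⟨c, d⟩ hcd hac
    simp only [Finset.mem_coe, Finset.mem_vaddAntidiagonal, HahnSeries.mem_support, vadd_eq_add]
      at hab hcd hac
    have h1 := hs a hab.1
    have h2 := hs c hcd.1
    ext <;> simp <;> omega
  · rintro ⟨a, b⟩ hab
    simp only [Finset.mem_coe, Finset.mem_vaddAntidiagonal, HahnSeries.mem_support, vadd_eq_add]
      at hab
    have h1 := hs a hab.1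
    simp only [Finset.coe_range, Set.mem_Iio]
    by_contra hlt
    refine hab.2.1 ?_
    have := hN a.toNat (not_lt.mp hlt)
    rwa [show n - (a.toNat : ℤ) = b by omega] at this
  · intro k _ hk
    by_contra hne
    refine hk ⟨((k : ℤ), n - k), ?_, by simp⟩
    simp only [Finset.mem_coe, Finset.mem_vaddAntidiagonal, HahnSeries.mem_support, vadd_eq_add]
    refine ⟨?_, ?_, by ring⟩
    · rw [HahnSeries.ofPowerSeries_apply_coeff]
      intro h0
      rw [h0, zero_smul] at hne
      exact hne rfl
    · intro h0
      refine hne ?_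
      rw [coeff, h0, smul_zero]
  · rintro ⟨a, b⟩ hab
    simp only [Finset.mem_vaddAntidiagonal, HahnSeries.mem_support, vadd_eq_add] at hab
    have h1 := hs a hab.1
    obtain ⟨k, rfl⟩ := Int.eq_ofNat_of_zero_le h1
    rw [HahnSeries.ofPowerSeries_apply_coeff]
    rw [show n - (((k : ℤ), b).1.toNat : ℤ) = b by simp; omega]
    rfl

/-- The coefficients of a product with a power series, in terms of the products of the coefficients. -/
theorem eventually_coeff_map_smul {P R M X : Type*} [CommRing P] [CommRing R] [AddCommGroup M]
    [Module R M] [AddCommGroup X] (φ : P →+* R) (c : M →+ X) (h : PowerSeries P)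
    (F : LaurentModule R M) (n : ℤ) (f : ℕ → P → M → X)
    (hf0 : ∀ N r, f N r 0 = 0)
    (hf : ∀ r m, ∀ᶠ N in atTop, c (φ r • m) = f N r m) :
    ∀ᶠ N : ℕ in atTop,
      c (coeff ((HahnSeries.ofPowerSeries ℤ R (PowerSeries.map φ h) : LaurentSeries R) • F) n) =
        ∑ k : Fin N, f N (PowerSeries.coeff k h) (coeff F (n - k)) := by
  -- The outer truncation K is fixed before N: only the finitely many k < K have to meet the inner
  -- thresholds, while for K ≤ k < N the coefficient of F vanishes and `hf0` makes the term zero.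
  have key := (eventually_coeff_ofPowerSeries_smul (PowerSeries.map φ h) F n).and
    (eventually_coeff_sub_eq_zero F n)
  obtain ⟨K, hK⟩ := eventually_atTop.mp key
  have h2 : ∀ᶠ N : ℕ in atTop, ∀ k ∈ Finset.range K,
      c (φ (PowerSeries.coeff k h) • coeff F (n - k)) =
        f N (PowerSeries.coeff k h) (coeff F (n - k)) :=
    (Finset.eventually_all _).mpr fun k _ => hf _ _
  filter_upwards [h2, eventually_ge_atTop K] with N hN hKN
  rw [(hK N hKN).1, map_sum, ← Fin.sum_univ_eq_sum_range
    (fun k => c (PowerSeries.coeff k (PowerSeries.map φ h) • coeff F (n - k)))]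
  refine Finset.sum_congr rfl fun k _ => ?_
  rw [PowerSeries.coeff_map]
  rcases lt_or_ge (k : ℕ) K with hk | hk
  · exact hN _ (Finset.mem_range.mpr hk)
  · rw [(hK K le_rfl).2 k hk, smul_zero, map_zero, hf0]

/-- The finitely supported exponent attached to an `n`-tuple. -/
def expo {n N : ℕ} (m : Fin n → Fin N) : Fin n →₀ ℕ :=
  Finsupp.equivFunOnFinite.symm fun a => (m a : ℕ)

@[simp] theorem expo_apply {n N : ℕ} (m : Fin n → Fin N) (a : Fin n) : expo m a = m a := rfl

/-- The part of the coefficient of `x^i` in the product of `g` and `∑ c(j) x^j` which comes from the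
monomials of `g` with exponents less than `N`. -/
def boxSum {n : ℕ} {W : Type*} [AddCommGroup W] [Module ℂ W] (N : ℕ) (g : MvPowerSeries (Fin n) ℂ)
    (c : (Fin n → ℤ) → W) (i : Fin n → ℤ) : W :=
  ∑ m : Fin n → Fin N, MvPowerSeries.coeff (expo m) g • c fun a => i a - (m a : ℕ)

variable {W : Type*} [AddCommGroup W] [Module ℂ W]

@[simp] theorem boxSum_zero {n : ℕ} (N : ℕ) (g : MvPowerSeries (Fin n) ℂ) (i : Fin n → ℤ) :
    boxSum N g (0 : (Fin n → ℤ) → W) i = 0 := by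
  simp [boxSum]

/-- A permutation of the variables maps the cube of exponents to itself, so this is a reindexing; a
box with different side lengths would not do. -/
theorem boxSum_rename {n : ℕ} (σ : Equiv.Perm (Fin n)) (N : ℕ) (g : MvPowerSeries (Fin n) ℂ)
    (c d : (Fin n → ℤ) → W) (h : ∀ i, c i = d (i ∘ σ.symm)) (i : Fin n → ℤ) :
    boxSum N g c i = boxSum N (MvPowerSeries.rename σ.toEmbedding g) d (i ∘ σ.symm) := by
  refine Fintype.sum_equiv (Equiv.arrowCongr σ (Equiv.refl _)) _ _ fun m => ?_
  have h1 : expo ((Equiv.arrowCongr σ (Equiv.refl _)) m) = Finsupp.embDomain σ.toEmbedding (expo m) := by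
    ext a
    obtain ⟨b, rfl⟩ := σ.surjective a
    have h2 := Finsupp.embDomain_apply_self σ.toEmbedding (expo m) b
    rw [Equiv.coe_toEmbedding] at h2
    rw [h2]
    simp
  rw [h1, MvPowerSeries.coeff_embDomain_rename, h]
  rfl

/-- Splitting off the last variable. -/
theorem boxSum_snoc {n : ℕ} (N : ℕ) (g : MvPowerSeries (Fin (n + 1)) ℂ)
    (c : (Fin (n + 1) → ℤ) → W) (i : Fin (n + 1) → ℤ)
    (G : ℕ → MvPowerSeries (Fin n) ℂ)
    (hG : ∀ k m, MvPowerSeries.coeff m (G k) =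
      MvPowerSeries.coeff (Finsupp.equivFunOnFinite.symm (Fin.snoc (α := fun _ => ℕ) m k)) g) :
    boxSum N g c i = ∑ k : Fin N,
      boxSum N (G k) (fun j => c (Fin.snoc (α := fun _ => ℤ) j (i (Fin.last n) - (k : ℕ))))
        fun a => i a.castSucc := by
  simp only [boxSum]
  rw [← Fintype.sum_prod_type' (f := fun (k : Fin N) (m : Fin n → Fin N) => _)]
  refine Fintype.sum_equiv (Fin.snocEquiv (fun _ => Fin N)).symm _ _ fun m => ?_
  rw [hG]
  congr 1
  · refine congrArg (fun e => MvPowerSeries.coeff e g) (Finsupp.ext fun a => ?_)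
    refine Fin.lastCases ?_ (fun b => ?_) a <;> simp [expo, Fin.snocEquiv, Fin.init]
  · refine congrArg c (funext fun a => ?_)
    refine Fin.lastCases ?_ (fun b => ?_) a <;> simp [Fin.snocEquiv, Fin.init]

end Coefficients

/-! ## The embedding of `ℂ_*(x₁,x₂,x₃)` and the coefficients of a product -/

section Expansions

variable {W : Type*} [AddCommGroup W] [Module ℂ W]

/-- Inductive step from n to n + 1 variables: `h` is `g` read as a series in its last variable,
which is the outermost variable of the Laurent series. Starting from n = 0 it yields the cases of
one, two and three variables. -/
theorem eventually_coeff_smul_eq_boxSum {n : ℕ} {R M : Type*} [CommRing R] [AddCommGroup M]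
    [Module R M] (φ : MvPowerSeries (Fin n) ℂ →+* R) (cf : M →+ ((Fin n → ℤ) → W))
    (hcf : ∀ r m i, ∀ᶠ N in atTop, cf (φ r • m) i = boxSum N r (cf m) i)
    (g : MvPowerSeries (Fin (n + 1)) ℂ) (h : PowerSeries (MvPowerSeries (Fin n) ℂ))
    (hG : ∀ k m, MvPowerSeries.coeff m (PowerSeries.coeff k h) =
      MvPowerSeries.coeff (Finsupp.equivFunOnFinite.symm (Fin.snoc (α := fun _ => ℕ) m k)) g)
    (F : LaurentModule R M) (i : Fin (n + 1) → ℤ) :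
    ∀ᶠ N : ℕ in atTop,
      cf (coeff ((HahnSeries.ofPowerSeries ℤ R (PowerSeries.map φ h) : LaurentSeries R) • F)
          (i (Fin.last n))) (fun a => i a.castSucc) =
        boxSum N g (fun j => cf (coeff F (j (Fin.last n))) fun a => j a.castSucc) i := by
  have := eventually_coeff_map_smul φ
    ((Pi.evalAddMonoidHom (fun _ => W) (fun a : Fin n => i a.castSucc)).comp cf) h F (i (Fin.last n))
    (fun N r m => boxSum N r (cf m) fun a => i a.castSucc) (fun N r => by simp) (fun r m => hcf r m _)
  filter_upwards [this] with N hN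
  rw [boxSum_snoc N g _ i (fun k => PowerSeries.coeff k h) hG]
  refine hN.trans (Finset.sum_congr rfl fun k _ => ?_)
  simp

/-- The coefficients of `F ∈ W((x₁))`. -/
def cf₁ : E1 W →+ ((Fin 1 → ℤ) → W) where
  toFun F i := coeff F (i 0)
  map_zero' := rfl
  map_add' _ _ := rfl

/-- The coefficients of `F ∈ W((x₁))((x₂))`. -/
def cf₂ : E2 W →+ ((Fin 2 → ℤ) → W) where
  toFun F i := coeff₂ F (i 0) (i 1)
  map_zero' := rfl
  map_add' _ _ := rfl

/-- The coefficients of `F ∈ W((x₁))((x₂))((x₃))`. -/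
def cf₃ : E3 W →+ ((Fin 3 → ℤ) → W) where
  toFun F i := coeff₂ (coeff F (i 2)) (i 0) (i 1)
  map_zero' := rfl
  map_add' _ _ := rfl

theorem cf₁_expand1_smul (g : MvPowerSeries (Fin 1) ℂ) (F : E1 W) (i : Fin 1 → ℤ) :
    ∀ᶠ N in atTop, cf₁ (expand1 g • F) i = boxSum N g (cf₁ F) i := by
  refine eventually_coeff_smul_eq_boxSum (W := W) (MvPowerSeries.isEmptyEquiv (Fin 0) ℂ).toRingHom
    (AddMonoidHom.mk' (fun w (_ : Fin 0 → ℤ) => w) fun _ _ => rfl) (fun r m i => ?_) g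
    (MvPowerSeries.finSuccEquiv ℂ 0 g) (fun k m => ?_) F i
  · refine Eventually.of_forall fun N => ?_
    rw [boxSum, Fintype.sum_unique]
    change (MvPowerSeries.isEmptyEquiv (Fin 0) ℂ r) • m = _ • m
    congr 1
    rw [MvPowerSeries.isEmptyEquiv_apply, ← MvPowerSeries.coeff_zero_eq_constantCoeff_apply]
    exact congrArg (fun e => MvPowerSeries.coeff e r) (Subsingleton.elim _ _)
  · rw [MvPowerSeries.coeff_coeff_finSuccEquiv]
    refine congrArg (fun e => MvPowerSeries.coeff e g) (Finsupp.ext fun a => ?_)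
    fin_cases a
    rfl

/-- `finSuccEquiv` splits off variable 0, whereas the outermost variable is the last one; the
renaming `e` moves the last variable to position 0 and shifts the others up. -/
theorem coeff_coeff_finSuccEquiv_rename {n : ℕ} (e : Fin (n + 1) ↪ Fin (n + 1))
    (h0 : e (Fin.last n) = 0) (h1 : ∀ a : Fin n, e a.castSucc = a.succ)
    (g : MvPowerSeries (Fin (n + 1)) ℂ) (k : ℕ) (m : Fin n →₀ ℕ) :
    MvPowerSeries.coeff m (PowerSeries.coeff k
      (MvPowerSeries.finSuccEquiv ℂ n (MvPowerSeries.rename e g))) =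
    MvPowerSeries.coeff (Finsupp.equivFunOnFinite.symm (Fin.snoc (α := fun _ => ℕ) m k)) g := by
  rw [MvPowerSeries.coeff_coeff_finSuccEquiv, ← MvPowerSeries.coeff_embDomain_rename e g]
  refine congrArg (fun d => MvPowerSeries.coeff d _) (Finsupp.ext fun a => ?_)
  refine Fin.cases ?_ (fun b => ?_) a
  · rw [← h0, Finsupp.embDomain_apply_self]
    simp [h0]
  · rw [← h1, Finsupp.embDomain_apply_self]
    simp [h1]

theorem cf₂_expand2_smul (g : MvPowerSeries (Fin 2) ℂ) (F : E2 W) (i : Fin 2 → ℤ) :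
    ∀ᶠ N in atTop, cf₂ (expand2 g • F) i = boxSum N g (cf₂ F) i :=
  eventually_coeff_smul_eq_boxSum (W := W) expand1.toRingHom cf₁ cf₁_expand1_smul g _
    (coeff_coeff_finSuccEquiv_rename _ rfl (fun a => by fin_cases a; rfl) g) F i

/-- The cyclic permutation which makes the last variable the first one. -/
def rot : Fin 3 ↪ Fin 3 := ⟨![1, 2, 0], by decide⟩

/-- The inclusion `ℂ[[x₁,x₂,x₃]] → ℂ((x₁))((x₂))((x₃))`. -/
def expand3 : MvPowerSeries (Fin 3) ℂ →ₐ[ℂ] L3 :=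
  (HahnSeries.ofPowerSeriesAlg (Γ := ℤ) (R := ℂ) (A := L2)).comp
    ((PowerSeries.mapAlgHom expand2).comp
      ((MvPowerSeries.finSuccEquiv ℂ 2).toAlgHom.comp (MvPowerSeries.rename (R := ℂ) rot)))

theorem expand3_injective : Function.Injective expand3 := by
  refine (HahnSeries.ofPowerSeries_injective (Γ := ℤ) (R := L2)).comp ?_
  exact (PowerSeries.map_injective _ expand2_injective).comp
    ((MvPowerSeries.finSuccEquiv ℂ 2).injective.comp (MvPowerSeries.rename_injective _))

theorem cf₃_expand3_smul (g : MvPowerSeries (Fin 3) ℂ) (F : E3 W) (i : Fin 3 → ℤ) :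
    ∀ᶠ N in atTop, cf₃ (expand3 g • F) i = boxSum N g (cf₃ F) i :=
  eventually_coeff_smul_eq_boxSum (W := W) expand2.toRingHom cf₂ cf₂_expand2_smul g _
    (coeff_coeff_finSuccEquiv_rename _ rfl (fun a => by fin_cases a <;> rfl) g) F i

/-- The embedding `ℂ_*(x₁,x₂,x₃) → ℂ((x₁))((x₂))((x₃))`. -/
def iota3 : CStar 3 →ₐ[ℂ] L3 :=
  CStar.lift expand3 (by
    intro p hp
    have h : expand3 (p : MvPowerSeries (Fin 3) ℂ) ≠ 0 := fun h => hp
      (MvPolynomial.coe_injective _ _ (expand3_injective (by simpa using h)))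
    exact h.isUnit)

theorem iota_algebraMap (g : MvPowerSeries (Fin 2) ℂ) :
    iota (algebraMap _ (CStar 2) g) = expand2 g := CStar.lift_algebraMap _ _ _

theorem iota3_algebraMap (g : MvPowerSeries (Fin 3) ℂ) :
    iota3 (algebraMap _ (CStar 3) g) = expand3 g := CStar.lift_algebraMap _ _ _

/-! ### Denominators, injectivity and renaming in ℂ_*(x₁,…,xₙ) -/

namespace CStar

variable {n : ℕ}

theorem nonzeroPolys_le : nonzeroPolys n ≤ nonZeroDivisors (MvPowerSeries (Fin n) ℂ) := by
  rintro _ ⟨p, hp, rfl⟩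
  refine mem_nonZeroDivisors_of_ne_zero fun h => nonZeroDivisors.ne_zero hp ?_
  exact MvPolynomial.coe_injective _ _ (by simpa using h)

instance : IsDomain (CStar n) := 
  haveI : IsDomain (MvPowerSeries (Fin n) ℂ) := NoZeroDivisors.to_isDomain _
  IsLocalization.isDomain_localization nonzeroPolys_le

/-- Clearing a denominator: the device by which statements about power series are extended to
ℂ_*(x₁,…,xₙ). -/
theorem exists_ofPoly_mul (h : CStar n) : ∃ (q : MvPolynomial (Fin n) ℂ)
    (g : MvPowerSeries (Fin n) ℂ), q ≠ 0 ∧ ofPoly q * h = algebraMap _ (CStar n) g := by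
  obtain ⟨⟨g, ⟨_, q, hq, rfl⟩⟩, hg⟩ := IsLocalization.surj (nonzeroPolys n) h
  exact ⟨q, g, nonZeroDivisors.ne_zero hq, by rw [mul_comm]; exact hg⟩

/-- A homomorphism out of `ℂ_*(x₁,…,xₙ)` is injective if it is so on power series. -/
theorem lift_injective {B : Type*} [CommRing B] [IsDomain B] (φ : CStar n →+* B)
    (h : Function.Injective fun g : MvPowerSeries (Fin n) ℂ => φ (algebraMap _ (CStar n) g)) :
    Function.Injective φ := by
  rw [injective_iff_map_eq_zero]
  intro a ha
  obtain ⟨q, g, hq, hg⟩ := exists_ofPoly_mul a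
  have h1 : g = 0 := h (by simp [← hg, ha])
  rw [h1, map_zero] at hg
  exact (mul_eq_zero.mp hg).resolve_left (isUnit_ofPoly hq).ne_zero

theorem algHom_ext {B : Type*} [CommRing B] [Algebra ℂ B] {φ ψ : CStar n →ₐ[ℂ] B}
    (h : ∀ g : MvPowerSeries (Fin n) ℂ, φ (algebraMap _ (CStar n) g) = ψ (algebraMap _ (CStar n) g)) : φ = ψ := by
  have : φ.toRingHom = ψ.toRingHom :=
    IsLocalization.ringHom_ext (nonzeroPolys n) (RingHom.ext h)
  exact AlgHom.ext fun a => congrArg (fun f : CStar n →+* B => f a) this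

theorem rename_algebraMap {m : ℕ} (e : Fin m ↪ Fin n) (g : MvPowerSeries (Fin m) ℂ) :
    rename e (algebraMap _ (CStar m) g) = algebraMap _ (CStar n) (MvPowerSeries.rename e g) :=
  lift_algebraMap _ _ _

theorem rename_ofPoly {m : ℕ} (e : Fin m ↪ Fin n) (p : MvPolynomial (Fin m) ℂ) :
    rename e (ofPoly p) = ofPoly (MvPolynomial.rename e p) := by
  rw [ofPoly, rename_algebraMap, MvPowerSeries.rename_coe, ofPoly]

theorem rename_rename {l m : ℕ} (e : Fin l ↪ Fin m) (f : Fin m ↪ Fin n) (a : CStar l) :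
    rename f (rename e a) = rename (e.trans f) a := by
  refine DFunLike.congr_fun (f := (rename f).comp (rename e)) (g := rename (e.trans f))
    (algHom_ext fun g => ?_) a
  simp only [AlgHom.comp_apply, rename_algebraMap]
  congr 1
  exact MvPowerSeries.rename_rename _ _ _

theorem rename_refl (a : CStar n) : rename (Function.Embedding.refl _) a = a := by
  refine DFunLike.congr_fun (f := rename (Function.Embedding.refl _)) (g := AlgHom.id ℂ _)
    (algHom_ext fun g => ?_) a
  rw [rename_algebraMap]
  exact congrArg _ (MvPowerSeries.rename_id_apply g)

theorem rename_injective {m : ℕ} (e : Fin m ↪ Fin n) : Function.Injective (rename e) := by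
  refine lift_injective (rename e).toRingHom fun f g h => ?_
  simp only [AlgHom.toRingHom_eq_coe, RingHom.coe_coe, rename_algebraMap] at h
  exact MvPowerSeries.rename_injective e (IsLocalization.injective _ nonzeroPolys_le h)

theorem ofPoly_mul (p q : MvPolynomial (Fin n) ℂ) : ofPoly (p * q) = ofPoly p * ofPoly q := by
  simp [ofPoly]

theorem ofPoly_one : ofPoly (1 : MvPolynomial (Fin n) ℂ) = 1 := by
  simp [ofPoly]

end CStar

theorem iota3_injective : Function.Injective iota3 := by
  refine CStar.lift_injective iota3.toRingHom fun f g h => ?_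
  simp only [AlgHom.toRingHom_eq_coe, RingHom.coe_coe, iota3_algebraMap] at h
  exact expand3_injective h

end Expansions

/-! ## Equality of expansions in different orders of the variables -/

/-- An expansion of `ℂ_*(x₁,…,xₙ)` in a field `L` of iterated Laurent series, acting on a space `E` of
iterated Laurent series with coefficients in `W`. -/
structure Expansion (n : ℕ) (W L E : Type*) [AddCommGroup W] [Module ℂ W] [Field L] [Algebra ℂ L]
    [AddCommGroup E] [Module L E] where
  /-- The embedding of `ℂ_*(x₁,…,xₙ)`. -/
  ι : CStar n →ₐ[ℂ] L
  /-- The coefficients of a series. -/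
  cf : E →+ ((Fin n → ℤ) → W)
  cf_injective : Function.Injective cf
  cf_smul : ∀ (g : MvPowerSeries (Fin n) ℂ) (F : E) (i : Fin n → ℤ),
    ∀ᶠ N in atTop, cf (ι (algebraMap _ (CStar n) g) • F) i = boxSum N g (cf F) i

/-! ### Calculus of equality up to a nonzero polynomial -/

namespace Expansion

variable {n : ℕ} {W L E X : Type*} [AddCommGroup W] [Module ℂ W] [Field L] [Algebra ℂ L]
    [AddCommGroup E] [Module L E] (e : Expansion n W L E)

/-- `F` and `G` are the same formal series, where the variable `xₐ` of `F` corresponds to the variable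
with index `σ a` of `G`. -/
def Eqv (σ : Equiv.Perm (Fin n)) (F G : E) : Prop := ∀ i, e.cf F i = e.cf G (i ∘ σ.symm)

variable {e} {σ τ : Equiv.Perm (Fin n)} {F G H : E}

theorem Eqv.add {F' G' : E} (h : e.Eqv σ F G) (h' : e.Eqv σ F' G') : e.Eqv σ (F + F') (G + G') :=
  fun i => by simp [h i, h' i]

theorem Eqv.symm (h : e.Eqv σ F G) : e.Eqv σ⁻¹ G F := fun i => by
  rw [h]
  refine congrArg _ (funext fun a => ?_)
  simp [Equiv.Perm.inv_def]

theorem Eqv.trans (h : e.Eqv σ F G) (h' : e.Eqv τ G H) : e.Eqv (τ * σ) F H := fun i => by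
  rw [h, h']
  rfl

theorem Eqv.unique (h : e.Eqv σ F G) (h' : e.Eqv σ F H) : G = H := by
  refine e.cf_injective (funext fun i => ?_)
  have := (h (i ∘ σ)).symm.trans (h' (i ∘ σ))
  rwa [Function.comp_assoc, Equiv.self_comp_symm] at this

/-- At a given exponent a single N computes both coefficients as sums over the same cube, and
`boxSum_rename` matches the two sums. -/
theorem Eqv.smul (h : e.Eqv σ F G) (g : MvPowerSeries (Fin n) ℂ) :
    e.Eqv σ (e.ι (algebraMap _ (CStar n) g) • F)
      (e.ι (CStar.rename σ.toEmbedding (algebraMap _ (CStar n) g)) • G) := fun i => by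
  rw [CStar.rename_algebraMap]
  obtain ⟨N, h1, h2⟩ := ((e.cf_smul g F i).and (e.cf_smul _ G (i ∘ σ.symm))).exists
  rw [h1, h2]
  exact boxSum_rename σ N g _ _ h i

theorem Eqv.smul_ofPoly (h : e.Eqv σ F G) (p : MvPolynomial (Fin n) ℂ) :
    e.Eqv σ (e.ι (CStar.ofPoly p) • F) (e.ι (CStar.rename σ.toEmbedding (CStar.ofPoly p)) • G) :=
  h.smul _

variable (e) in
/-- The families `Φ`, `Ψ` of formal series (in variables permuted by `σ`) agree after multiplication by
some nonzero polynomial. -/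
def Rel (σ : Equiv.Perm (Fin n)) (Φ Ψ : X → E) : Prop :=
  ∃ p : MvPolynomial (Fin n) ℂ, p ≠ 0 ∧ ∀ x, e.Eqv σ (e.ι (CStar.ofPoly p) • Φ x)
    (e.ι (CStar.rename σ.toEmbedding (CStar.ofPoly p)) • Ψ x)

theorem ι_ofPoly_ne_zero (e : Expansion n W L E) {p : MvPolynomial (Fin n) ℂ} (hp : p ≠ 0) :
    e.ι (CStar.ofPoly p) ≠ 0 :=
  ((CStar.isUnit_ofPoly hp).map e.ι).ne_zero

variable {Φ Ψ Θ Φ' Ψ' : X → E}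

theorem Rel.add (h : e.Rel σ Φ Ψ) (h' : e.Rel σ Φ' Ψ') : e.Rel σ (Φ + Φ') (Ψ + Ψ') := by
  obtain ⟨p, hp, h⟩ := h
  obtain ⟨q, hq, h'⟩ := h'
  refine ⟨p * q, mul_ne_zero hp hq, fun x => ?_⟩
  have h1 := ((h x).smul_ofPoly q).add ((h' x).smul_ofPoly p)
  simp only [smul_smul, ← map_mul] at h1
  simp only [Pi.add_apply, smul_add, CStar.ofPoly_mul]
  rwa [mul_comm (CStar.ofPoly q)] at h1

/-- Only power series can multiply an `Eqv`, since a quotient is expanded differently in the two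
orders; the denominator of `a` is therefore absorbed into the polynomial of the relation. -/
theorem Rel.smul (h : e.Rel σ Φ Ψ) (a : CStar n) :
    e.Rel σ (e.ι a • Φ) (e.ι (CStar.rename σ.toEmbedding a) • Ψ) := by
  obtain ⟨p, hp, h⟩ := h
  obtain ⟨q, g, hq, hg⟩ := CStar.exists_ofPoly_mul a
  refine ⟨p * q, mul_ne_zero hp hq, fun x => ?_⟩
  have h1 := (h x).smul g
  rw [← hg] at h1
  simp only [smul_smul, ← map_mul] at h1
  simp only [Pi.smul_apply, smul_smul, ← map_mul, CStar.ofPoly_mul]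
  rwa [mul_comm, ← mul_assoc] at h1

theorem rename_ofPoly_ne_zero {p : MvPolynomial (Fin n) ℂ} (hp : p ≠ 0) (σ : Equiv.Perm (Fin n)) :
    MvPolynomial.rename σ p ≠ 0 := fun h =>
  hp (MvPolynomial.rename_injective σ σ.injective (by simpa using h))

theorem _root_.QuasiVA.CStar.rename_perm_mul (a : CStar n) :
    CStar.rename τ.toEmbedding (CStar.rename σ.toEmbedding a) =
      CStar.rename (τ * σ).toEmbedding a := CStar.rename_rename _ _ _

theorem _root_.QuasiVA.CStar.rename_perm_one (a : CStar n) :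
    CStar.rename (1 : Equiv.Perm (Fin n)).toEmbedding a = a := CStar.rename_refl a

theorem _root_.QuasiVA.CStar.rename_perm_ofPoly (p : MvPolynomial (Fin n) ℂ) :
    CStar.ofPoly (MvPolynomial.rename σ p) = CStar.rename σ.toEmbedding (CStar.ofPoly p) :=
  (CStar.rename_ofPoly σ.toEmbedding p).symm

theorem Rel.symm (h : e.Rel σ Φ Ψ) : e.Rel σ⁻¹ Ψ Φ := by
  obtain ⟨p, hp, h⟩ := h
  refine ⟨MvPolynomial.rename σ p, rename_ofPoly_ne_zero hp σ, fun x => ?_⟩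
  rw [CStar.rename_perm_ofPoly, CStar.rename_perm_mul, inv_mul_cancel, CStar.rename_perm_one]
  exact (h x).symm

theorem Rel.trans (h : e.Rel σ Φ Ψ) (h' : e.Rel τ Ψ Θ) : e.Rel (τ * σ) Φ Θ := by
  obtain ⟨p, hp, h⟩ := h
  obtain ⟨q, hq, h'⟩ := h'
  -- The polynomial q is written in the variables of the middle series, so it is pulled back along σ
  -- to those of the first.
  refine ⟨p * MvPolynomial.rename (σ⁻¹ : Equiv.Perm (Fin n)) q, mul_ne_zero hp (rename_ofPoly_ne_zero hq _), fun x => ?_⟩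
  have h1 := (h x).smul_ofPoly (MvPolynomial.rename (σ⁻¹ : Equiv.Perm (Fin n)) q)
  rw [CStar.rename_perm_ofPoly, CStar.rename_perm_mul, mul_inv_cancel, CStar.rename_perm_one] at h1
  have h2 := (h' x).smul_ofPoly (MvPolynomial.rename σ p)
  rw [CStar.rename_perm_ofPoly, CStar.rename_perm_mul] at h2
  simp only [smul_smul, ← map_mul] at h1 h2
  rw [mul_comm] at h2
  have h3 := h1.trans h2
  rw [CStar.ofPoly_mul, CStar.rename_perm_ofPoly, map_mul (CStar.rename (τ * σ).toEmbedding),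
    CStar.rename_perm_mul, mul_assoc τ, mul_inv_cancel, mul_one]
  rwa [mul_comm (CStar.rename (σ⁻¹).toEmbedding _)] at h3

/-- Both right-hand sides become equal after multiplication by the same nonzero element of the field
L, and this can be cancelled in the vector space E. -/
theorem Rel.unique (h : e.Rel σ Φ Ψ) (h' : e.Rel σ Φ Θ) : Ψ = Θ := by
  obtain ⟨p, hp, h⟩ := h
  obtain ⟨q, hq, h'⟩ := h'
  funext x
  have h1 := (h x).smul_ofPoly q
  have h2 := (h' x).smul_ofPoly p
  simp only [smul_smul, ← map_mul] at h1 h2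
  rw [mul_comm] at h1
  have h3 := h1.unique h2
  rw [mul_comm, ← CStar.ofPoly_mul, ← CStar.rename_perm_ofPoly] at h3
  exact smul_right_injective E
    (e.ι_ofPoly_ne_zero (rename_ofPoly_ne_zero (mul_ne_zero hq hp) σ)) h3

theorem Rel.zero : e.Rel σ (0 : X → E) 0 :=
  ⟨1, one_ne_zero, fun _ _ => by simp⟩

end Expansion

variable (W : Type*) [AddCommGroup W] [Module ℂ W]

/-- `W((x₁))((x₂))` as a space of formal series. -/
def expansion₂ : Expansion 2 W L2 (E2 W) where
  ι := iota
  cf := cf₂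
  cf_injective := fun F G h => coeff_ext fun j => coeff_ext fun i => congrFun h ![i, j]
  cf_smul g F i := by
    rw [iota_algebraMap]
    exact cf₂_expand2_smul g F i

/-- `W((x₁))((x₂))((x₃))` as a space of formal series. -/
def expansion₃ : Expansion 3 W L3 (E3 W) where
  ι := iota3
  cf := cf₃
  cf_injective := fun F G h =>
    coeff_ext fun k => coeff_ext fun j => coeff_ext fun i => congrFun h ![i, j, k]
  cf_smul g F i := by
    rw [iota3_algebraMap]
    exact cf₃_expand3_smul g F i

variable {W}

theorem eqAfterMul_iff (p : MvPolynomial (Fin 2) ℂ) (F G : E2 W) :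
    EqAfterMul p F G ↔ (expansion₂ W).Eqv (Equiv.swap 0 1) (iota (CStar.ofPoly p) • F)
      (iota (CStar.rename (Equiv.swap (0 : Fin 2) 1).toEmbedding (CStar.ofPoly p)) • G) := by
  rw [← CStar.rename_perm_ofPoly]
  exact ⟨fun h i => h (i 0) (i 1), fun h i j => h ![i, j]⟩

theorem exists_eqAfterMul_iff {X : Type*} (Φ Ψ : X → E2 W) :
    (∃ p : MvPolynomial (Fin 2) ℂ, p ≠ 0 ∧ ∀ w, EqAfterMul p (Φ w) (Ψ w)) ↔
      (expansion₂ W).Rel (Equiv.swap 0 1) Φ Ψ := by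
  simp only [eqAfterMul_iff]
  rfl

/-! ## Two of three variables -/

section Variables

variable {W : Type*} [AddCommGroup W] [Module ℂ W]

/-- The renamed series involves only variables in the image of `e`, so only the exponents that
vanish elsewhere contribute. Positivity of N ensures that the exponent 0 lies in the cube. -/
theorem boxSum_rename_embedding {m n : ℕ} (e : Fin m ↪ Fin n) {N : ℕ} (hN : 0 < N)
    (g : MvPowerSeries (Fin m) ℂ) (c : (Fin n → ℤ) → W) (i : Fin n → ℤ) :
    boxSum N (MvPowerSeries.rename e g) c i =
      boxSum N g (fun j => c (Function.extend e j i)) (i ∘ e) := by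
  symm
  have hexp : ∀ k : Fin m → Fin N,
      expo (Function.extend e k fun _ => ⟨0, hN⟩) = Finsupp.embDomain e (expo k) := by
    intro k
    ext a
    by_cases ha : ∃ b, e b = a
    · obtain ⟨b, rfl⟩ := ha
      rw [Finsupp.embDomain_apply_self, expo_apply, e.injective.extend_apply, expo_apply]
    · rw [Finsupp.embDomain_of_notMem_range _ _ _ (by simpa using ha), expo_apply,
        Function.extend_apply' _ _ _ ha]
  refine Finset.sum_of_injOn (fun k => Function.extend e k fun _ => ⟨0, hN⟩)
    (Function.extend_injective e.injective _).injOn (fun _ _ => by simp) ?_ ?_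
  · intro k _ hk
    rw [MvPowerSeries.coeff_rename_eq_zero, zero_smul]
    rintro ⟨d, hd⟩
    rw [← Finsupp.embDomain_eq_mapDomain] at hd
    refine hk ⟨fun b => k (e b), by simp, funext fun a => ?_⟩
    by_cases ha : ∃ b, e b = a
    · obtain ⟨b, rfl⟩ := ha
      exact e.injective.extend_apply _ _ _
    · refine (Function.extend_apply' _ _ _ ha).trans (Fin.ext ?_)
      rw [← expo_apply k a, ← hd, Finsupp.embDomain_of_notMem_range _ _ _ (by simpa using ha)]
  · intro k _
    rw [hexp, MvPowerSeries.coeff_embDomain_rename]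
    refine congrArg (fun j => _ • c j) (funext fun a => ?_)
    by_cases ha : ∃ b, e b = a
    · obtain ⟨b, rfl⟩ := ha
      rw [e.injective.extend_apply, e.injective.extend_apply]
      rfl
    · rw [Function.extend_apply' _ _ _ ha, Function.extend_apply' _ _ _ ha]
      simp

/-- Compatibility with power series includes the denominator q and the numerator q·a; as β q acts
injectively on E', it extends to a. -/
theorem map_smul_of_powerSeries {m : ℕ} {L L' E E' : Type*} [Field L] [Algebra ℂ L] [AddCommGroup E]
    [Module L E] [Field L'] [Algebra ℂ L'] [AddCommGroup E'] [Module L' E'] (α : CStar m →ₐ[ℂ] L)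
    (β : CStar m →ₐ[ℂ] L') (T : E →+ E')
    (h : ∀ (g : MvPowerSeries (Fin m) ℂ) F, T (α (algebraMap _ (CStar m) g) • F) =
      β (algebraMap _ (CStar m) g) • T F) (a : CStar m) (F : E) :
    T (α a • F) = β a • T F := by
  obtain ⟨q, g, hq, hg⟩ := CStar.exists_ofPoly_mul a
  have h0 : β (CStar.ofPoly q) ≠ 0 := ((CStar.isUnit_ofPoly hq).map β).ne_zero
  refine smul_right_injective E' h0 ?_
  have h1 := h (q : MvPowerSeries (Fin m) ℂ) (α a • F)
  rw [smul_smul, ← map_mul, ← CStar.ofPoly, hg, h, ← hg, map_mul, mul_smul] at h1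
  exact h1.symm

/-- The embedding of the first two of three variables. -/
abbrev e12 : Fin 2 ↪ Fin 3 := CStar.pair 0 1 (by decide)
/-- The embedding of the last two of three variables. -/
abbrev e23 : Fin 2 ↪ Fin 3 := CStar.pair 1 2 (by decide)
/-- The embedding of the first and the last of three variables. -/
abbrev e13 : Fin 2 ↪ Fin 3 := CStar.pair 0 2 (by decide)

/-- The coefficient of `x₃^k`. -/
def coeffHom (k : ℤ) : E3 W →+ E2 W where
  toFun F := coeff F k
  map_zero' := rfl
  map_add' _ _ := rfl

theorem extend_e12 (j : Fin 2 → ℤ) (i : Fin 3 → ℤ) :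
    Function.extend e12 j i = ![j 0, j 1, i 2] := by
  funext a
  fin_cases a
  · exact e12.injective.extend_apply j i 0
  · exact e12.injective.extend_apply j i 1
  · refine Function.extend_apply' j i (2 : Fin 3) ?_
    decide

theorem extend_e23 (j : Fin 2 → ℤ) (i : Fin 3 → ℤ) :
    Function.extend e23 j i = ![i 0, j 0, j 1] := by
  funext a
  fin_cases a
  · refine Function.extend_apply' j i (0 : Fin 3) ?_
    decide
  · exact e23.injective.extend_apply j i 0
  · exact e23.injective.extend_apply j i 1

/-- As x₃ is the outermost variable, functions of x₁, x₂ act on each coefficient of x₃^k separately.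
-/
theorem coeff_iota3_smul (a : CStar 2) (F : E3 W) (k : ℤ) :
    coeff (iota3 (CStar.rename e12 a) • F) k = iota a • coeff F k := by
  refine map_smul_of_powerSeries (iota3.comp (CStar.rename e12)) iota (coeffHom k)
    (fun g F => (expansion₂ W).cf_injective (funext fun j => ?_)) a F
  rw [AlgHom.comp_apply, CStar.rename_algebraMap]
  have h1 := (expansion₃ W).cf_smul (MvPowerSeries.rename e12 g) F ![j 0, j 1, k]
  have h2 := (expansion₂ W).cf_smul g (coeff F k) j
  obtain ⟨N, h1, h2, hN⟩ := (h1.and (h2.and (eventually_gt_atTop 0))).exists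
  refine Eq.trans h1 (Eq.trans ?_ h2.symm)
  rw [boxSum_rename_embedding e12 hN]
  simp only [extend_e12]
  rfl

/-- The series `a(x₁)F(x₂,x₃)`, where `a(x₁)` is applied to the coefficients of `F`. -/
def applyLeft (a : Fld W) : E2 W →+ E3 W where
  toFun F := HahnModule.of L2 (((HahnModule.of L1).symm F).map (apply₂ a))
  map_zero' := coeff_ext fun _ => (apply₂ a).map_zero
  map_add' _ _ := coeff_ext fun _ => (apply₂ a).map_add _ _

theorem cf₃_applyLeft (a : Fld W) (F : E2 W) (i : Fin 3 → ℤ) :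
    cf₃ (applyLeft a F) i = coeff (a (cf₂ F ![i 1, i 2])) (i 0) := rfl

/-- Each coefficient of a product with a power series in x₂, x₃ is a finite sum, and the ℂ-linear
field `f` passes through it. -/
theorem applyLeft_smul (f : Fld W) (a : CStar 2) (F : E2 W) :
    applyLeft f (iota a • F) = iota3 (CStar.rename e23 a) • applyLeft f F := by
  refine map_smul_of_powerSeries iota (iota3.comp (CStar.rename e23)) (applyLeft f)
    (fun g F => (expansion₃ W).cf_injective (funext fun i => ?_)) a F
  rw [AlgHom.comp_apply, CStar.rename_algebraMap]
  have h1 := (expansion₃ W).cf_smul (MvPowerSeries.rename e23 g) (applyLeft f F) i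
  have h2 := (expansion₂ W).cf_smul g F ![i 1, i 2]
  obtain ⟨N, h1, h2, hN⟩ := (h1.and (h2.and (eventually_gt_atTop 0))).exists
  refine Eq.trans ?_ h1.symm
  rw [boxSum_rename_embedding e23 hN]
  refine (cf₃_applyLeft f _ i).trans ((congrArg (fun w => coeff (f w) (i 0)) h2).trans ?_)
  simp only [boxSum, extend_e23]
  let c : E1 W →ₗ[ℂ] W :=
    { toFun := fun F => coeff F (i 0), map_add' := fun _ _ => rfl, map_smul' := fun _ _ => rfl }
  change (c ∘ₗ f) _ = _
  rw [map_sum]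
  refine Finset.sum_congr rfl fun k _ => ?_
  rw [map_smul]
  rfl

end Variables

/-! ## Products of two and three vertex operators -/

section Products

instance instSMulCommClassE2 {W : Type*} [AddCommGroup W] [Module ℂ W] : SMulCommClass ℂ L2 (E2 W) :=
  IsScalarTower.to_smulCommClass (R := ℂ) (A := L2) (M := E2 W)

instance instSMulCommClassE2' {W : Type*} [AddCommGroup W] [Module ℂ W] : SMulCommClass L2 ℂ (E2 W) :=
  SMulCommClass.symm _ _ _

theorem rTensor_algHom_smul {A B U : Type*} [CommRing A] [Algebra ℂ A] [CommRing B] [Algebra ℂ B]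
    [AddCommGroup U] [Module ℂ U] (φ : A →ₐ[ℂ] B) (a : A) (t : A ⊗[ℂ] U) :
    LinearMap.rTensor U φ.toLinearMap (a • t) = φ a • LinearMap.rTensor U φ.toLinearMap t := by
  induction t using TensorProduct.induction_on with
  | zero => simp
  | tmul b x => simp [TensorProduct.smul_tmul']
  | add x y hx hy => simp only [smul_add, map_add, hx, hy]

namespace QuasiModule

variable {V W : Type*} [AddCommGroup V] [Module ℂ V] [AddCommGroup W] [Module ℂ W]
  {A : NonlocalVertexAlgebra V} (M : QuasiModule A W)

/-- `u ⊗ v ↦ Y_W(u,x₁)Y_W(v,x₂)`. -/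
def Y₂ : V ⊗[ℂ] V →ₗ[ℂ] (W →ₗ[ℂ] E2 W) :=
  TensorProduct.lift <| LinearMap.mk₂ ℂ (fun u v => apply₂ (M.Y u) ∘ₗ M.Y v)
    (fun _ _ _ => by simp only [map_add, apply₂_add, LinearMap.add_comp])
    (fun _ _ _ => by simp only [map_smul, apply₂_smul, LinearMap.smul_comp])
    (fun _ _ _ => by simp only [map_add, LinearMap.comp_add])
    (fun _ _ _ => by simp only [map_smul, LinearMap.comp_smul])

/-- The linear map `u ⊗ v ⊗ f ↦ ι(f) Y_W(u,x₁)Y_W(v,x₂)` on `V ⊗ V ⊗ ℂ_*(x₁,x₂)`. -/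
def prod₂ : CStar 2 ⊗[ℂ] (V ⊗[ℂ] V) →ₗ[ℂ] (W →ₗ[ℂ] E2 W) :=
  (LinearMap.liftBaseChange L2 M.Y₂).restrictScalars ℂ ∘ₗ
    LinearMap.rTensor (V ⊗[ℂ] V) iota.toLinearMap

/-- The linear map `u ⊗ v ⊗ w ⊗ f ↦ ι(f) Y_W(u,x₁)Y_W(v,x₂)Y_W(w,x₃)` on `V^{⊗3} ⊗ ℂ_*(x₁,x₂,x₃)`. -/
def prod₃ : CStar 3 ⊗[ℂ] (V ⊗[ℂ] (V ⊗[ℂ] V)) →ₗ[ℂ] (W →ₗ[ℂ] E3 W) where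
  toFun t := M.pi₃ (LinearMap.rTensor (V ⊗[ℂ] (V ⊗[ℂ] V)) iota3.toLinearMap t)
  map_add' s t := by rw [map_add, map_add]
  map_smul' c t := by
    rw [← algebraMap_smul (CStar 3) c t, rTensor_algHom_smul, map_smul, AlgHom.commutes,
      algebraMap_smul, RingHom.id_apply]

theorem prod₂_tmul (f : CStar 2) (u v : V) (w : W) :
    M.prod₂ (f ⊗ₜ (u ⊗ₜ v)) w = iota f • apply₂ (M.Y u) (M.Y v w) := rfl

theorem prod₂_smul (f : CStar 2) (t : CStar 2 ⊗[ℂ] (V ⊗[ℂ] V)) (w : W) :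
    M.prod₂ (f • t) w = iota f • M.prod₂ t w := by
  simp only [prod₂, LinearMap.comp_apply, rTensor_algHom_smul]
  rw [LinearMap.restrictScalars_apply, map_smul]
  rfl

theorem prod₃_tmul (f : CStar 3) (t : V ⊗[ℂ] (V ⊗[ℂ] V)) (w : W) :
    M.prod₃ (f ⊗ₜ t) w = iota3 f • M.Y₃ t w := by
  change M.pi₃ (iota3 f ⊗ₜ t) w = _
  rw [pi₃, LinearMap.liftBaseChange_tmul, LinearMap.smul_apply]

theorem prod₃_smul (f : CStar 3) (t : CStar 3 ⊗[ℂ] (V ⊗[ℂ] (V ⊗[ℂ] V))) (w : W) :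
    M.prod₃ (f • t) w = iota3 f • M.prod₃ t w := by
  change M.pi₃ (LinearMap.rTensor _ _ (f • t)) w = _
  rw [rTensor_algHom_smul, map_smul]
  rfl

end QuasiModule

/-! ### Adjoining a third tensor factor -/

variable {V : Type*} [AddCommGroup V] [Module ℂ V]

/-- `f(x₁,x₂) ⊗ (a ⊗ b) ↦ f(x₁,x₂) ⊗ (a ⊗ b ⊗ v)`. -/
def tensorRight (v : V) : CStar 2 ⊗[ℂ] (V ⊗[ℂ] V) →ₗ[ℂ] CStar 3 ⊗[ℂ] (V ⊗[ℂ] (V ⊗[ℂ] V)) :=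
  TensorProduct.map (CStar.rename e12).toLinearMap
    ((TensorProduct.assoc ℂ V V V).toLinearMap ∘ₗ (TensorProduct.mk ℂ (V ⊗[ℂ] V) V).flip v)

/-- `f(x₁,x₂) ⊗ (a ⊗ b) ↦ f(x₂,x₃) ⊗ (u ⊗ a ⊗ b)`. -/
def tensorLeft (u : V) : CStar 2 ⊗[ℂ] (V ⊗[ℂ] V) →ₗ[ℂ] CStar 3 ⊗[ℂ] (V ⊗[ℂ] (V ⊗[ℂ] V)) :=
  TensorProduct.map (CStar.rename e23).toLinearMap (TensorProduct.mk ℂ V (V ⊗[ℂ] V) u)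

@[simp] theorem tensorRight_tmul (v : V) (f : CStar 2) (a b : V) :
    tensorRight v (f ⊗ₜ (a ⊗ₜ b)) = CStar.rename e12 f ⊗ₜ (a ⊗ₜ (b ⊗ₜ v)) := rfl

@[simp] theorem tensorLeft_tmul (u : V) (f : CStar 2) (t : V ⊗[ℂ] V) :
    tensorLeft u (f ⊗ₜ t) = CStar.rename e23 f ⊗ₜ (u ⊗ₜ t) := rfl

/-- Over a field all modules are flat, so tensoring with a nonzero vector is injective, and so is
renaming the coefficients. -/
theorem tensorRight_injective {v : V} (hv : v ≠ 0) : Function.Injective (tensorRight v) := by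
  have h1 : Function.Injective ((TensorProduct.mk ℂ (V ⊗[ℂ] V) V).flip v) := by
    have h2 : (TensorProduct.mk ℂ (V ⊗[ℂ] V) V).flip v =
        LinearMap.lTensor (V ⊗[ℂ] V) (LinearMap.toSpanSingleton ℂ V v) ∘ₗ
          (TensorProduct.rid ℂ (V ⊗[ℂ] V)).symm.toLinearMap := by
      refine LinearMap.ext fun t => ?_
      simp
    rw [h2]
    exact (Module.Flat.lTensor_preserves_injective_linearMap _
      (LinearMap.ker_eq_bot.mp (LinearMap.ker_toSpanSingleton ℂ hv))).comp
      (TensorProduct.rid ℂ (V ⊗[ℂ] V)).symm.injective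
  rw [tensorRight, ← LinearMap.lTensor_comp_rTensor]
  exact (Module.Flat.lTensor_preserves_injective_linearMap
      ((TensorProduct.assoc ℂ V V V).toLinearMap ∘ₗ (TensorProduct.mk ℂ (V ⊗[ℂ] V) V).flip v)
      ((TensorProduct.assoc ℂ V V V).injective.comp h1)).comp
    (Module.Flat.rTensor_preserves_injective_linearMap (CStar.rename e12).toLinearMap
      (CStar.rename_injective e12))

namespace QuasiModule

variable {W : Type*} [AddCommGroup W] [Module ℂ W]
  {A : NonlocalVertexAlgebra V} (M : QuasiModule A W)

/-- The rightmost operator acts first: its coefficient of x₃^k turns w into another vector of W, on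
which a two-factor product then acts. This reduces three-factor statements to two-factor ones. -/
theorem coeff_prod₃_tensorRight (v : V) (t : CStar 2 ⊗[ℂ] (V ⊗[ℂ] V)) (w : W) (k : ℤ) :
    coeff (M.prod₃ (tensorRight v t) w) k = M.prod₂ t (coeff (M.Y v w) k) := by
  induction t using TensorProduct.induction_on with
  | zero => simp; rfl
  | add x y hx hy => simp only [map_add, LinearMap.add_apply, coeff_add, hx, hy]
  | tmul f x =>
    induction x using TensorProduct.induction_on with
    | zero => simp; rfl
    | add x y hx hy =>
      simp only [TensorProduct.tmul_add, map_add, LinearMap.add_apply, coeff_add, hx, hy]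
    | tmul a b =>
      rw [tensorRight_tmul, prod₃_tmul, coeff_iota3_smul, prod₂_tmul]
      rfl

theorem prod₃_tensorLeft (u : V) (t : CStar 2 ⊗[ℂ] (V ⊗[ℂ] V)) (w : W) :
    M.prod₃ (tensorLeft u t) w = applyLeft (M.Y u) (M.prod₂ t w) := by
  induction t using TensorProduct.induction_on with
  | zero => simp
  | add x y hx hy => simp only [map_add, LinearMap.add_apply, hx, hy]
  | tmul f x =>
    induction x using TensorProduct.induction_on with
    | zero => simp
    | add x y hx hy =>
      simp only [TensorProduct.tmul_add, map_add, LinearMap.add_apply, hx, hy]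
    | tmul a b =>
      rw [tensorLeft_tmul, prod₃_tmul, prod₂_tmul, applyLeft_smul]
      rfl

variable {M}

theorem prod₃_injective (hinj : Function.Injective M.pi₃) : Function.Injective M.prod₃ :=
  hinj.comp (Module.Flat.rTensor_preserves_injective_linearMap iota3.toLinearMap iota3_injective)

theorem prod₂_injective (hinj : Function.Injective M.pi₃) : Function.Injective M.prod₂ := by
  -- A zero vacuum forces V = 0, since every v is the constant term of Y(v,x)1; otherwise the vacuum
  -- can serve as third factor.
  by_cases hv : A.vac = 0
  · have : Subsingleton V := subsingleton_of_forall_eq 0 fun v => by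
      rw [← A.creation_zero v, hv, map_zero]
      rfl
    exact Function.injective_of_subsingleton _
  · refine (injective_iff_map_eq_zero _).mpr fun t ht => ?_
    refine (injective_iff_map_eq_zero _).mp (tensorRight_injective hv) t ?_
    refine (injective_iff_map_eq_zero _).mp (prod₃_injective hinj) _ ?_
    refine LinearMap.ext fun w => coeff_ext fun k => ?_
    rw [coeff_prod₃_tensorRight, ht]
    rfl

/-! ### The relations between products in different orders -/

variable (M)

/-- The relation `t(x₁,x₂) Y_W(·,x₁)Y_W(·,x₂) ∼ s(x₂,x₁) Y_W(·,x₂)Y_W(·,x₁)` between elements `t`, `s` of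
`V ⊗ V ⊗ ℂ_*(x₁,x₂)`: equality after multiplication by a nonzero polynomial. -/
def Rel₂ (t s : CStar 2 ⊗[ℂ] (V ⊗[ℂ] V)) : Prop :=
  (expansion₂ W).Rel (Equiv.swap 0 1) (M.prod₂ t) (M.prod₂ s)

/-- The similar relation between elements of `V^{⊗3} ⊗ ℂ_*(x₁,x₂,x₃)`, for a permutation of the
variables. -/
def Rel₃ (σ : Equiv.Perm (Fin 3)) (t s : CStar 3 ⊗[ℂ] (V ⊗[ℂ] (V ⊗[ℂ] V))) : Prop :=
  (expansion₃ W).Rel σ (M.prod₃ t) (M.prod₃ s)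

variable {M}

theorem Rel₂.add {t s t' s' : CStar 2 ⊗[ℂ] (V ⊗[ℂ] V)} (h : M.Rel₂ t s) (h' : M.Rel₂ t' s') :
    M.Rel₂ (t + t') (s + s') := by
  have := Expansion.Rel.add h h'
  rw [Rel₂, map_add, map_add]
  exact this

theorem Rel₂.smul {t s : CStar 2 ⊗[ℂ] (V ⊗[ℂ] V)} (h : M.Rel₂ t s) (f : CStar 2) :
    M.Rel₂ (f • t) (CStar.rename (Equiv.swap (0 : Fin 2) 1).toEmbedding f • s) := by
  have := Expansion.Rel.smul h f
  refine Eq.mp ?_ this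
  rw [Rel₂]
  congr 1 <;> exact funext fun w => (M.prod₂_smul _ _ w).symm

theorem Rel₂.symm {t s : CStar 2 ⊗[ℂ] (V ⊗[ℂ] V)} (h : M.Rel₂ t s) : M.Rel₂ s t := by
  have := Expansion.Rel.symm h
  rwa [Equiv.swap_inv] at this

theorem Rel₂.unique (hinj : Function.Injective M.pi₃) {t s s' : CStar 2 ⊗[ℂ] (V ⊗[ℂ] V)}
    (h : M.Rel₂ t s) (h' : M.Rel₂ t s') : s = s' :=
  prod₂_injective hinj (DFunLike.coe_injective (Expansion.Rel.unique h h'))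

theorem Rel₂.zero : M.Rel₂ 0 0 := by
  rw [Rel₂, map_zero]
  exact Expansion.Rel.zero

theorem Rel₃.add {σ : Equiv.Perm (Fin 3)} {t s t' s' : CStar 3 ⊗[ℂ] (V ⊗[ℂ] (V ⊗[ℂ] V))}
    (h : M.Rel₃ σ t s) (h' : M.Rel₃ σ t' s') : M.Rel₃ σ (t + t') (s + s') := by
  have := Expansion.Rel.add h h'
  rw [Rel₃, map_add, map_add]
  exact this

theorem Rel₃.smul {σ : Equiv.Perm (Fin 3)} {t s : CStar 3 ⊗[ℂ] (V ⊗[ℂ] (V ⊗[ℂ] V))}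
    (h : M.Rel₃ σ t s) (f : CStar 3) :
    M.Rel₃ σ (f • t) (CStar.rename σ.toEmbedding f • s) := by
  have := Expansion.Rel.smul h f
  refine Eq.mp ?_ this
  rw [Rel₃]
  congr 1 <;> exact funext fun w => (M.prod₃_smul _ _ w).symm

theorem Rel₃.unique (hinj : Function.Injective M.pi₃) {σ : Equiv.Perm (Fin 3)}
    {t s s' : CStar 3 ⊗[ℂ] (V ⊗[ℂ] (V ⊗[ℂ] V))} (h : M.Rel₃ σ t s) (h' : M.Rel₃ σ t s') : s = s' :=
  prod₃_injective hinj (DFunLike.coe_injective (Expansion.Rel.unique h h'))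

theorem Rel₃.zero {σ : Equiv.Perm (Fin 3)} : M.Rel₃ σ 0 0 := by
  rw [Rel₃, map_zero]
  exact Expansion.Rel.zero

/-- The relation is used at the vectors that are the coefficients of Y_W(v,x₃)w. This needs the
polynomial to be independent of the vector of W. -/
theorem Rel₂.tensorRight {t s : CStar 2 ⊗[ℂ] (V ⊗[ℂ] V)} (h : M.Rel₂ t s) (v : V) :
    M.Rel₃ (Equiv.swap 0 1) (tensorRight v t) (tensorRight v s) := by
  obtain ⟨p, hp, h⟩ := h
  refine ⟨MvPolynomial.rename e12 p, fun h0 =>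
    hp (MvPolynomial.rename_injective e12 e12.injective (by simpa using h0)), fun w i => ?_⟩
  rw [← CStar.rename_ofPoly, CStar.rename_rename]
  have he : e12.trans (Equiv.swap (0 : Fin 3) 1).toEmbedding =
      (Equiv.swap (0 : Fin 2) 1).toEmbedding.trans e12 := by decide
  rw [he, ← CStar.rename_rename]
  have h1 := h (coeff (M.Y v w) (i 2)) ![i 0, i 1]
  change coeff₂ _ _ _ = coeff₂ _ _ _ at h1
  change coeff₂ (coeff (iota3 _ • _) _) _ _ = coeff₂ (coeff (iota3 _ • _) _) _ _
  rw [coeff_iota3_smul, coeff_iota3_smul, coeff_prod₃_tensorRight, coeff_prod₃_tensorRight]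
  exact h1

/-- Y_W(u,x₁) is applied to every coefficient of the relation in x₂, x₃; by `applyLeft_smul` it
commutes with the polynomial factor. -/
theorem Rel₂.tensorLeft {t s : CStar 2 ⊗[ℂ] (V ⊗[ℂ] V)} (h : M.Rel₂ t s) (u : V) :
    M.Rel₃ (Equiv.swap 1 2) (tensorLeft u t) (tensorLeft u s) := by
  obtain ⟨p, hp, h⟩ := h
  refine ⟨MvPolynomial.rename e23 p, fun h0 =>
    hp (MvPolynomial.rename_injective e23 e23.injective (by simpa using h0)), fun w i => ?_⟩
  rw [← CStar.rename_ofPoly, CStar.rename_rename]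
  have he : e23.trans (Equiv.swap (1 : Fin 3) 2).toEmbedding =
      (Equiv.swap (0 : Fin 2) 1).toEmbedding.trans e23 := by decide
  rw [he, ← CStar.rename_rename]
  have h1 := h w ![i 1, i 2]
  change cf₂ _ _ = cf₂ _ _ at h1
  change cf₃ (iota3 _ • _) _ = cf₃ (iota3 _ • _) _
  rw [prod₃_tensorLeft, prod₃_tensorLeft, ← applyLeft_smul, ← applyLeft_smul, cf₃_applyLeft,
    cf₃_applyLeft]
  exact congrArg (fun x => coeff (M.Y u x) (i 0)) h1

end QuasiModule

end Products

/-! ## Operators with coefficients: naturality -/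

section Naturality

variable {A B : Type} [CommRing A] [Algebra ℂ A] [CommRing B] [Algebra ℂ B]

theorem map_algHom_smul {U U' : Type*} [AddCommGroup U] [Module ℂ U] [AddCommGroup U'] [Module ℂ U']
    (φ : A →ₐ[ℂ] B) (τ : U →ₗ[ℂ] U') (a : A) (t : A ⊗[ℂ] U) :
    TensorProduct.map φ.toLinearMap τ (a • t) = φ a • TensorProduct.map φ.toLinearMap τ t := by
  induction t using TensorProduct.induction_on with
  | zero => simp
  | tmul b x => simp [TensorProduct.smul_tmul']
  | add x y hx hy => simp only [smul_add, map_add, hx, hy]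

theorem tmul_eq_smul_one {U : Type*} [AddCommGroup U] [Module ℂ U] (a : A) (x : U) :
    a ⊗ₜ[ℂ] x = a • ((1 : A) ⊗ₜ[ℂ] x) := by
  rw [TensorProduct.smul_tmul', smul_eq_mul, mul_one]

section

variable {U : Type*} [AddCommGroup U] [Module ℂ U]

@[simp] theorem ext_tmul (R : U →ₗ[ℂ] A ⊗[ℂ] U) (a : A) (x : U) : ext A R (a ⊗ₜ x) = a • R x :=
  LinearMap.liftBaseChange_tmul _ _ _ _

theorem mapCoeff_apply (φ : A →ₐ[ℂ] B) (R : U →ₗ[ℂ] A ⊗[ℂ] U) (x : U) :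
    mapCoeff φ R x = LinearMap.rTensor U φ.toLinearMap (R x) := rfl

theorem mapCoeff_mapCoeff {C : Type} [CommRing C] [Algebra ℂ C] (φ : A →ₐ[ℂ] B) (ψ : B →ₐ[ℂ] C)
    (R : U →ₗ[ℂ] A ⊗[ℂ] U) : mapCoeff ψ (mapCoeff φ R) = mapCoeff (ψ.comp φ) R := by
  refine LinearMap.ext fun x => ?_
  simp only [mapCoeff_apply]
  rw [← LinearMap.comp_apply, ← LinearMap.rTensor_comp]
  rfl

theorem mapCoeff_id (R : U →ₗ[ℂ] A ⊗[ℂ] U) : mapCoeff (AlgHom.id ℂ A) R = R := by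
  refine LinearMap.ext fun x => ?_
  rw [mapCoeff_apply]
  exact LinearMap.rTensor_id_apply U A (R x)

/-- Change of coefficients is compatible with composition. -/
theorem ext_mapCoeff_map (φ : A →ₐ[ℂ] B) (R : U →ₗ[ℂ] A ⊗[ℂ] U) (t : A ⊗[ℂ] U) :
    ext B (mapCoeff φ R) (LinearMap.rTensor U φ.toLinearMap t) =
      LinearMap.rTensor U φ.toLinearMap (ext A R t) := by
  induction t using TensorProduct.induction_on with
  | zero => simp
  | tmul b x => simp [mapCoeff_apply, rTensor_algHom_smul]
  | add x y hx hy => simp only [map_add, hx, hy]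

/-- Operators `P` which act on the coefficients by `φ` and on the vectors by `τ` intertwine the
extensions of operators which they intertwine on vectors. -/
theorem map_ext (φ : A →ₐ[ℂ] B) (τ : U →ₗ[ℂ] U) (R : U →ₗ[ℂ] A ⊗[ℂ] U) (R' : U →ₗ[ℂ] B ⊗[ℂ] U)
    (h : ∀ x, LinearMap.lTensor B τ (mapCoeff φ R x) = R' (τ x)) (t : A ⊗[ℂ] U) :
    TensorProduct.map φ.toLinearMap τ (ext A R t) =
      ext B R' (TensorProduct.map φ.toLinearMap τ t) := by
  induction t using TensorProduct.induction_on with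
  | zero => simp
  | tmul b x =>
    rw [ext_tmul, map_algHom_smul, TensorProduct.map_tmul, ext_tmul, ← h, mapCoeff_apply,
      ← LinearMap.lTensor_comp_rTensor]
    rfl
  | add x y hx hy => simp only [map_add, hx, hy]

end

variable {V : Type*} [AddCommGroup V] [Module ℂ V]

theorem mapCoeff_op21 (φ : A →ₐ[ℂ] B) (R : V ⊗[ℂ] V →ₗ[ℂ] A ⊗[ℂ] (V ⊗[ℂ] V)) :
    mapCoeff φ (op21 R) = op21 (mapCoeff φ R) := by
  refine LinearMap.ext fun x => ?_
  simp only [mapCoeff_apply, op21, LinearMap.comp_apply]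
  rw [← LinearMap.comp_apply, LinearMap.rTensor_comp_lTensor, ← LinearMap.lTensor_comp_rTensor]
  rfl

theorem rTensor_assoc (φ : A →ₐ[ℂ] B) (s : A ⊗[ℂ] (V ⊗[ℂ] V)) (t : V) :
    LinearMap.rTensor _ φ.toLinearMap (LinearMap.lTensor A (TensorProduct.assoc ℂ V V V).toLinearMap
      (TensorProduct.assoc ℂ A (V ⊗[ℂ] V) V (s ⊗ₜ t))) =
    LinearMap.lTensor B (TensorProduct.assoc ℂ V V V).toLinearMap
      (TensorProduct.assoc ℂ B (V ⊗[ℂ] V) V (LinearMap.rTensor _ φ.toLinearMap s ⊗ₜ t)) := by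
  induction s using TensorProduct.induction_on with
  | zero => simp
  | tmul b x => simp
  | add x y hx hy => simp only [TensorProduct.add_tmul, map_add, hx, hy]

theorem op12_tmul (R : V ⊗[ℂ] V →ₗ[ℂ] A ⊗[ℂ] (V ⊗[ℂ] V)) (u v t : V) :
    op12 R (u ⊗ₜ (v ⊗ₜ t)) = LinearMap.lTensor A (TensorProduct.assoc ℂ V V V).toLinearMap
      (TensorProduct.assoc ℂ A (V ⊗[ℂ] V) V (R (u ⊗ₜ v) ⊗ₜ t)) := rfl

theorem op23_tmul (R : V ⊗[ℂ] V →ₗ[ℂ] A ⊗[ℂ] (V ⊗[ℂ] V)) (u : V) (t : V ⊗[ℂ] V) :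
    op23 R (u ⊗ₜ t) = TensorProduct.leftComm ℂ V A (V ⊗[ℂ] V) (u ⊗ₜ R t) := rfl

theorem op13_apply (R : V ⊗[ℂ] V →ₗ[ℂ] A ⊗[ℂ] (V ⊗[ℂ] V)) (x : V ⊗[ℂ] (V ⊗[ℂ] V)) :
    op13 R x = LinearMap.lTensor A (LinearMap.lTensor V (TensorProduct.comm ℂ V V).toLinearMap)
      (op12 R (LinearMap.lTensor V (TensorProduct.comm ℂ V V).toLinearMap x)) := rfl

theorem mapCoeff_op12 (φ : A →ₐ[ℂ] B) (R : V ⊗[ℂ] V →ₗ[ℂ] A ⊗[ℂ] (V ⊗[ℂ] V)) :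
    mapCoeff φ (op12 R) = op12 (mapCoeff φ R) := by
  refine TensorProduct.ext' fun u x => ?_
  induction x using TensorProduct.induction_on with
  | zero => simp
  | add x y hx hy => simp only [TensorProduct.tmul_add, map_add, hx, hy]
  | tmul v t => rw [mapCoeff_apply, op12_tmul, op12_tmul, rTensor_assoc, mapCoeff_apply]

theorem mapCoeff_op13 (φ : A →ₐ[ℂ] B) (R : V ⊗[ℂ] V →ₗ[ℂ] A ⊗[ℂ] (V ⊗[ℂ] V)) :
    mapCoeff φ (op13 R) = op13 (mapCoeff φ R) := by
  refine LinearMap.ext fun x => ?_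
  rw [mapCoeff_apply, op13_apply, op13_apply, ← LinearMap.comp_apply (LinearMap.rTensor _ _),
    LinearMap.rTensor_comp_lTensor, ← LinearMap.lTensor_comp_rTensor, LinearMap.comp_apply,
    ← mapCoeff_apply, mapCoeff_op12]

theorem rTensor_leftComm (φ : A →ₐ[ℂ] B) (s : A ⊗[ℂ] (V ⊗[ℂ] V)) (u : V) :
    LinearMap.rTensor _ φ.toLinearMap (TensorProduct.leftComm ℂ V A (V ⊗[ℂ] V) (u ⊗ₜ s)) =
      TensorProduct.leftComm ℂ V B (V ⊗[ℂ] V) (u ⊗ₜ LinearMap.rTensor _ φ.toLinearMap s) := by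
  induction s using TensorProduct.induction_on with
  | zero => simp
  | tmul b x => simp
  | add x y hx hy => simp only [TensorProduct.tmul_add, map_add, hx, hy]

theorem mapCoeff_op23 (φ : A →ₐ[ℂ] B) (R : V ⊗[ℂ] V →ₗ[ℂ] A ⊗[ℂ] (V ⊗[ℂ] V)) :
    mapCoeff φ (op23 R) = op23 (mapCoeff φ R) := by
  refine TensorProduct.ext' fun u x => ?_
  rw [mapCoeff_apply, op23_tmul, op23_tmul, rTensor_leftComm, mapCoeff_apply]

variable (V) in
/-- The flip of the first two factors of `V ⊗ V ⊗ V`. -/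
def flip12 : V ⊗[ℂ] (V ⊗[ℂ] V) →ₗ[ℂ] V ⊗[ℂ] (V ⊗[ℂ] V) :=
  (TensorProduct.leftComm ℂ V V V).toLinearMap

variable (V) in
/-- The flip of the last two factors of `V ⊗ V ⊗ V`. -/
def flip23 : V ⊗[ℂ] (V ⊗[ℂ] V) →ₗ[ℂ] V ⊗[ℂ] (V ⊗[ℂ] V) :=
  LinearMap.lTensor V (TensorProduct.comm ℂ V V).toLinearMap

@[simp] theorem flip12_tmul (u v t : V) : flip12 V (u ⊗ₜ (v ⊗ₜ t)) = v ⊗ₜ (u ⊗ₜ t) := by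
  simp [flip12]

@[simp] theorem flip23_tmul (u v t : V) : flip23 V (u ⊗ₜ (v ⊗ₜ t)) = u ⊗ₜ (t ⊗ₜ v) := by
  simp [flip23]

theorem lTensor_flip23_op12 (R : V ⊗[ℂ] V →ₗ[ℂ] A ⊗[ℂ] (V ⊗[ℂ] V)) (x : V ⊗[ℂ] (V ⊗[ℂ] V)) :
    LinearMap.lTensor A (flip23 V) (op12 R x) = op13 R (flip23 V x) := by
  rw [op13_apply]
  congr 2
  change x = (flip23 V ∘ₗ flip23 V) x
  rw [show flip23 V ∘ₗ flip23 V = LinearMap.id from TensorProduct.ext_threefold' fun u v t => by simp]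
  rfl

/-- R₁₃ is defined by conjugating R₁₂ with the flip of the last two factors; conjugating R₂₃ with
the flip of the first two yields the same operator. -/
theorem lTensor_flip12_op23 (R : V ⊗[ℂ] V →ₗ[ℂ] A ⊗[ℂ] (V ⊗[ℂ] V)) (x : V ⊗[ℂ] (V ⊗[ℂ] V)) :
    LinearMap.lTensor A (flip12 V) (op23 R x) = op13 R (flip12 V x) := by
  have key : ∀ (u : V) (s : A ⊗[ℂ] (V ⊗[ℂ] V)),
      LinearMap.lTensor A (flip12 V) (TensorProduct.leftComm ℂ V A (V ⊗[ℂ] V) (u ⊗ₜ s)) =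
        LinearMap.lTensor A (flip23 V) (LinearMap.lTensor A
          (TensorProduct.assoc ℂ V V V).toLinearMap
          (TensorProduct.assoc ℂ A (V ⊗[ℂ] V) V (s ⊗ₜ u))) := by
    intro u s
    induction s using TensorProduct.induction_on with
    | zero => simp
    | add x y hx hy => simp only [TensorProduct.tmul_add, TensorProduct.add_tmul, map_add, hx, hy]
    | tmul a y =>
      induction y using TensorProduct.induction_on with
      | zero => simp
      | add x y hx hy =>
        simp only [TensorProduct.tmul_add, TensorProduct.add_tmul, map_add, hx, hy]
      | tmul v t => simp
  induction x using TensorProduct.induction_on with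
  | zero => simp
  | add x y hx hy => simp only [map_add, hx, hy]
  | tmul u x =>
    induction x using TensorProduct.induction_on with
    | zero => simp
    | add x y hx hy => simp only [TensorProduct.tmul_add, map_add, hx, hy]
    | tmul v t =>
      rw [op23_tmul, key, flip12_tmul, op13_apply]
      rfl

end Naturality

/-! ## The operator `S`, unitarity and the quantum Yang–Baxter equation -/

section YangBaxter

variable {V W : Type*} [AddCommGroup V] [Module ℂ V] [AddCommGroup W] [Module ℂ W]
  {A : NonlocalVertexAlgebra V} {M : QuasiModule A W}

namespace QuasiModule

theorem pseudoLocalRel_iff (u v : V) {n : ℕ} (f : Fin n → CStar 2) (v' u' : Fin n → V) :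
    M.PseudoLocalRel u v f v' u' ↔
      M.Rel₂ (1 ⊗ₜ (u ⊗ₜ v)) (∑ i, f i ⊗ₜ (v' i ⊗ₜ u' i)) := by
  have h1 : ∀ w, M.prod₂ (1 ⊗ₜ (u ⊗ₜ v)) w = apply₂ (M.Y u) (M.Y v w) := fun w => by
    rw [prod₂_tmul, map_one, one_smul]
  have h2 : ∀ w, M.prod₂ (∑ i, f i ⊗ₜ (v' i ⊗ₜ u' i)) w =
      ∑ i, iota (f i) • apply₂ (M.Y (v' i)) (M.Y (u' i) w) := fun w => by
    rw [map_sum, LinearMap.sum_apply]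
    rfl
  rw [PseudoLocalRel, Rel₂, ← exists_eqAfterMul_iff]
  simp only [h1, h2]

/-- Relations add, so each tensor t, not only a pure one, has an element related to 1 ⊗ t. Any
choice of these is linear by uniqueness, and composing with the flip gives the convention S(v ⊗ u).
-/
theorem exists_operator (hpl : M.IsPseudoLocal) (hinj : Function.Injective M.pi₃) :
    ∃ S : V ⊗[ℂ] V →ₗ[ℂ] CStar 2 ⊗[ℂ] (V ⊗[ℂ] V), ∀ u v, M.Rel₂ (1 ⊗ₜ (u ⊗ₜ v)) (S (v ⊗ₜ u)) := by
  have h : ∀ t : V ⊗[ℂ] V, ∃ s, M.Rel₂ (1 ⊗ₜ t) s := by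
    intro t
    induction t using TensorProduct.induction_on with
    | zero => exact ⟨0, by rw [TensorProduct.tmul_zero]; exact Rel₂.zero⟩
    | add x y hx hy =>
      obtain ⟨s, hs⟩ := hx
      obtain ⟨s', hs'⟩ := hy
      exact ⟨s + s', by rw [TensorProduct.tmul_add]; exact hs.add hs'⟩
    | tmul u v =>
      obtain ⟨n, f, v', u', h⟩ := hpl u v
      exact ⟨_, (pseudoLocalRel_iff u v f v' u').mp h⟩
  choose S hS using h
  let S' : V ⊗[ℂ] V →ₗ[ℂ] CStar 2 ⊗[ℂ] (V ⊗[ℂ] V) :=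
    { toFun := S
      map_add' := fun x y => by
        refine Rel₂.unique hinj (hS _) ?_
        rw [TensorProduct.tmul_add]
        exact (hS x).add (hS y)
      map_smul' := fun c x => by
        refine Rel₂.unique hinj (hS _) ?_
        -- A constant is fixed by exchanging the variables, so it multiplies both sides alike.
        have := (hS x).smul (algebraMap ℂ (CStar 2) c)
        rwa [AlgHom.commutes, algebraMap_smul, algebraMap_smul, ← TensorProduct.tmul_smul] at this }
  refine ⟨S' ∘ₗ (TensorProduct.comm ℂ V V).toLinearMap, fun u v => ?_⟩
  exact hS (u ⊗ₜ v)

theorem isSQuasiModule_iff (S : V ⊗[ℂ] V →ₗ[ℂ] CStar 2 ⊗[ℂ] (V ⊗[ℂ] V)) :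
    M.IsSQuasiModule S ↔ ∀ u v, M.Rel₂ (1 ⊗ₜ (u ⊗ₜ v)) (S (v ⊗ₜ u)) := by
  refine forall₂_congr fun u v => ⟨?_, fun h => ?_⟩
  · rintro ⟨n, f, v', u', hS, h⟩
    rw [hS]
    exact (pseudoLocalRel_iff u v f v' u').mp h
  · have : ∃ (n : ℕ) (f : Fin n → CStar 2) (v' u' : Fin n → V),
        S (v ⊗ₜ u) = ∑ i, f i ⊗ₜ (v' i ⊗ₜ u' i) := by
      have hsum : ∀ s : CStar 2 ⊗[ℂ] (V ⊗[ℂ] V), ∃ l : List (CStar 2 × V × V),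
          s = (l.map fun x => x.1 ⊗ₜ (x.2.1 ⊗ₜ x.2.2)).sum := by
        intro s
        induction s using TensorProduct.induction_on with
        | zero => exact ⟨[], by simp⟩
        | add x y hx hy =>
          obtain ⟨l, rfl⟩ := hx
          obtain ⟨l', rfl⟩ := hy
          exact ⟨l ++ l', by simp⟩
        | tmul f y =>
          induction y using TensorProduct.induction_on with
          | zero => exact ⟨[], by simp⟩
          | add x y hx hy =>
            obtain ⟨l, hl⟩ := hx
            obtain ⟨l', hl'⟩ := hy
            exact ⟨l ++ l', by rw [TensorProduct.tmul_add, hl, hl']; simp⟩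
          | tmul a b => exact ⟨[(f, a, b)], by simp⟩
      obtain ⟨l, hl⟩ := hsum (S (v ⊗ₜ u))
      refine ⟨l.length, fun i => l[i].1, fun i => l[i].2.1, fun i => l[i].2.2, ?_⟩
      rw [hl, ← List.sum_ofFn]
      congr 1
      exact List.ext_getElem (by simp) (by simp)
    obtain ⟨n, f, v', u', hS⟩ := this
    exact ⟨n, f, v', u', hS, (pseudoLocalRel_iff u v f v' u').mpr (hS ▸ h)⟩

end QuasiModule

variable {S : V ⊗[ℂ] V →ₗ[ℂ] CStar 2 ⊗[ℂ] (V ⊗[ℂ] V)}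

theorem op12_rename_tmul (u v t : V) :
    op12 (mapCoeff (CStar.rename e12) S) (u ⊗ₜ (v ⊗ₜ t)) = tensorRight t (S (u ⊗ₜ v)) := by
  rw [op12_tmul, mapCoeff_apply, tensorRight]
  induction S (u ⊗ₜ v) using TensorProduct.induction_on with
  | zero => simp
  | add x y hx hy => simp only [TensorProduct.add_tmul, map_add, hx, hy]
  | tmul f x => rfl

theorem op23_rename_tmul (u : V) (x : V ⊗[ℂ] V) :
    op23 (mapCoeff (CStar.rename e23) S) (u ⊗ₜ x) = tensorLeft u (S x) := by
  rw [op23_tmul, mapCoeff_apply]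
  induction S x using TensorProduct.induction_on with
  | zero => simp
  | add x y hx hy => simp only [TensorProduct.tmul_add, map_add, hx, hy]
  | tmul f x => rfl

/-- The flip of the variables `x₁, x₂` and of the tensor factors. -/
def flip₂ : CStar 2 ⊗[ℂ] (V ⊗[ℂ] V) →ₗ[ℂ] CStar 2 ⊗[ℂ] (V ⊗[ℂ] V) :=
  TensorProduct.map (CStar.rename (Equiv.swap (0 : Fin 2) 1).toEmbedding).toLinearMap
    (TensorProduct.comm ℂ V V).toLinearMap

/-- The flip of the variables `x₁, x₂` and of the first two tensor factors. -/
def swap12 : CStar 3 ⊗[ℂ] (V ⊗[ℂ] (V ⊗[ℂ] V)) →ₗ[ℂ] CStar 3 ⊗[ℂ] (V ⊗[ℂ] (V ⊗[ℂ] V)) :=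
  TensorProduct.map (CStar.rename (Equiv.swap (0 : Fin 3) 1).toEmbedding).toLinearMap (flip12 V)

/-- The flip of the variables `x₂, x₃` and of the last two tensor factors. -/
def swap23 : CStar 3 ⊗[ℂ] (V ⊗[ℂ] (V ⊗[ℂ] V)) →ₗ[ℂ] CStar 3 ⊗[ℂ] (V ⊗[ℂ] (V ⊗[ℂ] V)) :=
  TensorProduct.map (CStar.rename (Equiv.swap (1 : Fin 3) 2).toEmbedding).toLinearMap (flip23 V)

theorem flip₂_flip₂ (t : CStar 2 ⊗[ℂ] (V ⊗[ℂ] V)) : flip₂ (flip₂ t) = t := by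
  refine DFunLike.congr_fun (f := flip₂ ∘ₗ flip₂) (g := LinearMap.id)
    (TensorProduct.ext_threefold' fun f u v => ?_) t
  simp only [LinearMap.comp_apply, flip₂, TensorProduct.map_tmul]
  rw [AlgHom.toLinearMap_apply, AlgHom.toLinearMap_apply, CStar.rename_perm_mul,
    Equiv.swap_mul_self, CStar.rename_perm_one]
  rfl

theorem swap12_swap12 (t : CStar 3 ⊗[ℂ] (V ⊗[ℂ] (V ⊗[ℂ] V))) : swap12 (swap12 t) = t := by
  refine DFunLike.congr_fun (f := swap12 ∘ₗ swap12) (g := LinearMap.id)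
    (TensorProduct.ext (LinearMap.ext fun f => TensorProduct.ext_threefold' fun u v x => ?_)) t
  simp [swap12, CStar.rename_perm_mul, CStar.rename_perm_one]

theorem swap23_swap23 (t : CStar 3 ⊗[ℂ] (V ⊗[ℂ] (V ⊗[ℂ] V))) : swap23 (swap23 t) = t := by
  refine DFunLike.congr_fun (f := swap23 ∘ₗ swap23) (g := LinearMap.id)
    (TensorProduct.ext (LinearMap.ext fun f => TensorProduct.ext_threefold' fun u v x => ?_)) t
  simp [swap23, CStar.rename_perm_mul, CStar.rename_perm_one]

theorem swap12_swap23_swap12 (t : CStar 3 ⊗[ℂ] (V ⊗[ℂ] (V ⊗[ℂ] V))) :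
    swap12 (swap23 (swap12 t)) = swap23 (swap12 (swap23 t)) := by
  refine DFunLike.congr_fun (f := swap12 ∘ₗ swap23 ∘ₗ swap12) (g := swap23 ∘ₗ swap12 ∘ₗ swap23)
    (TensorProduct.ext (LinearMap.ext fun f => TensorProduct.ext_threefold' fun u v x => ?_)) t
  have h : Equiv.swap (0 : Fin 3) 1 * (Equiv.swap 1 2 * Equiv.swap 0 1) =
      Equiv.swap 1 2 * (Equiv.swap 0 1 * Equiv.swap 1 2) := by decide
  simp [swap12, swap23, CStar.rename_perm_mul, h]

/-- The defining property of S extended to all coefficients: S ∘ `flip₂` is the braiding that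
rewrites a product in the opposite order. `rel₃_ext_op12` and `rel₃_ext_op23` are its versions for
neighbouring factors among three. -/
theorem rel₂_ext_flip₂ (hS : ∀ u v, M.Rel₂ (1 ⊗ₜ (u ⊗ₜ v)) (S (v ⊗ₜ u)))
    (t : CStar 2 ⊗[ℂ] (V ⊗[ℂ] V)) : M.Rel₂ t (ext (CStar 2) S (flip₂ t)) := by
  induction t using TensorProduct.induction_on with
  | zero => simpa using QuasiModule.Rel₂.zero
  | add x y hx hy => simpa only [map_add] using hx.add hy
  | tmul f x =>
    induction x using TensorProduct.induction_on with
    | zero => simpa using QuasiModule.Rel₂.zero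
    | add x y hx hy => simpa only [TensorProduct.tmul_add, map_add] using hx.add hy
    | tmul u v =>
      have := (hS u v).smul f
      rw [← tmul_eq_smul_one] at this
      simpa [flip₂] using this

theorem rel₃_ext_op12 (hS : ∀ u v, M.Rel₂ (1 ⊗ₜ (u ⊗ₜ v)) (S (v ⊗ₜ u)))
    (t : CStar 3 ⊗[ℂ] (V ⊗[ℂ] (V ⊗[ℂ] V))) :
    M.Rel₃ (Equiv.swap 0 1) t
      (ext (CStar 3) (op12 (mapCoeff (CStar.rename e12) S)) (swap12 t)) := by
  induction t using TensorProduct.induction_on with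
  | zero => simpa using QuasiModule.Rel₃.zero
  | add x y hx hy => simpa only [map_add] using hx.add hy
  | tmul f x =>
    induction x using TensorProduct.induction_on with
    | zero => simpa using QuasiModule.Rel₃.zero
    | add x y hx hy => simpa only [TensorProduct.tmul_add, map_add] using hx.add hy
    | tmul u x =>
      induction x using TensorProduct.induction_on with
      | zero => simpa using QuasiModule.Rel₃.zero
      | add x y hx hy => simpa only [TensorProduct.tmul_add, map_add] using hx.add hy
      | tmul v t =>
        have := ((hS u v).tensorRight t).smul f
        rw [tensorRight_tmul, map_one, ← tmul_eq_smul_one, ← op12_rename_tmul] at this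
        simpa [swap12] using this

theorem rel₃_ext_op23 (hS : ∀ u v, M.Rel₂ (1 ⊗ₜ (u ⊗ₜ v)) (S (v ⊗ₜ u)))
    (t : CStar 3 ⊗[ℂ] (V ⊗[ℂ] (V ⊗[ℂ] V))) :
    M.Rel₃ (Equiv.swap 1 2) t
      (ext (CStar 3) (op23 (mapCoeff (CStar.rename e23) S)) (swap23 t)) := by
  induction t using TensorProduct.induction_on with
  | zero => simpa using QuasiModule.Rel₃.zero
  | add x y hx hy => simpa only [map_add] using hx.add hy
  | tmul f x =>
    induction x using TensorProduct.induction_on with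
    | zero => simpa using QuasiModule.Rel₃.zero
    | add x y hx hy => simpa only [TensorProduct.tmul_add, map_add] using hx.add hy
    | tmul u x =>
      induction x using TensorProduct.induction_on with
      | zero => simpa using QuasiModule.Rel₃.zero
      | add x y hx hy => simpa only [TensorProduct.tmul_add, map_add] using hx.add hy
      | tmul v t =>
        have := ((hS v t).tensorLeft u).smul f
        rw [tensorLeft_tmul, map_one, ← tmul_eq_smul_one, ← op23_rename_tmul] at this
        simpa [swap23] using this

theorem mapCoeff_rename_comp {k m n : ℕ} (a : Fin k ↪ Fin m) (b : Fin m ↪ Fin n)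
    (R : V ⊗[ℂ] V →ₗ[ℂ] CStar k ⊗[ℂ] (V ⊗[ℂ] V)) :
    mapCoeff (CStar.rename b) (mapCoeff (CStar.rename a) R) = mapCoeff (CStar.rename (a.trans b)) R := by
  rw [mapCoeff_mapCoeff]
  exact congrArg (fun φ => mapCoeff φ R) (AlgHom.ext fun x => CStar.rename_rename a b x)

theorem swap23_ext_op12 (t : CStar 3 ⊗[ℂ] (V ⊗[ℂ] (V ⊗[ℂ] V))) :
    swap23 (ext (CStar 3) (op12 (mapCoeff (CStar.rename e12) S)) t) =
      ext (CStar 3) (op13 (mapCoeff (CStar.rename e13) S)) (swap23 t) := by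
  refine map_ext _ _ _ _ (fun x => ?_) t
  rw [mapCoeff_op12, mapCoeff_rename_comp,
    show e12.trans (Equiv.swap (1 : Fin 3) 2).toEmbedding = e13 by decide]
  exact lTensor_flip23_op12 _ _

theorem swap12_ext_op23 (t : CStar 3 ⊗[ℂ] (V ⊗[ℂ] (V ⊗[ℂ] V))) :
    swap12 (ext (CStar 3) (op23 (mapCoeff (CStar.rename e23) S)) t) =
      ext (CStar 3) (op13 (mapCoeff (CStar.rename e13) S)) (swap12 t) := by
  refine map_ext _ _ _ _ (fun x => ?_) t
  rw [mapCoeff_op23, mapCoeff_rename_comp,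
    show e23.trans (Equiv.swap (0 : Fin 3) 1).toEmbedding = e13 by decide]
  exact lTensor_flip12_op23 _ _

theorem swap23_ext_op13 (t : CStar 3 ⊗[ℂ] (V ⊗[ℂ] (V ⊗[ℂ] V))) :
    swap23 (ext (CStar 3) (op13 (mapCoeff (CStar.rename e13) S)) t) =
      ext (CStar 3) (op12 (mapCoeff (CStar.rename e12) S)) (swap23 t) := by
  conv_lhs => rw [← swap23_swap23 t, ← swap23_ext_op12, swap23_swap23]

theorem swap12_ext_op13 (t : CStar 3 ⊗[ℂ] (V ⊗[ℂ] (V ⊗[ℂ] V))) :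
    swap12 (ext (CStar 3) (op13 (mapCoeff (CStar.rename e13) S)) t) =
      ext (CStar 3) (op23 (mapCoeff (CStar.rename e23) S)) (swap12 t) := by
  conv_lhs => rw [← swap12_swap12 t, ← swap12_ext_op23, swap12_swap12]

theorem ext_op21_rename (t : CStar 2 ⊗[ℂ] (V ⊗[ℂ] V)) :
    ext (CStar 2) (op21 (mapCoeff (CStar.rename (CStar.pair 1 0 (by decide))) S)) (flip₂ t) =
      flip₂ (ext (CStar 2) S t) := by
  rw [show CStar.pair (1 : Fin 2) 0 (by decide) = (Equiv.swap (0 : Fin 2) 1).toEmbedding by decide]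
  refine (map_ext _ _ _ _ (fun x => ?_) t).symm
  simp [op21]

theorem isUnitaryQYB (hinj : Function.Injective M.pi₃)
    (hS : ∀ u v, M.Rel₂ (1 ⊗ₜ (u ⊗ₜ v)) (S (v ⊗ₜ u))) : IsUnitaryQYB S where
  unitary := by
    refine LinearMap.ext fun t => ?_
    rw [LinearMap.comp_apply, ← flip₂_flip₂ (ext (CStar 2) S t), ext_op21_rename]
    -- S t is related to `flip₂ t` by symmetry and to S (`flip₂` (S t)) by the braiding, so these
    -- two are equal.
    have h1 := (rel₂_ext_flip₂ hS (flip₂ t)).symm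
    rw [flip₂_flip₂] at h1
    rw [QuasiModule.Rel₂.unique hinj (rel₂_ext_flip₂ hS _) h1, flip₂_flip₂]
    rfl
  yangBaxter := by
    intro S₁₂ S₁₃ S₂₃
    refine LinearMap.ext fun t => ?_
    -- The braid relation: both words of exchanges relate x to an element through the same
    -- permutation of the variables, and that element is unique.
    have key : ∀ x, S₁₂ (swap12 (S₂₃ (swap23 (S₁₂ (swap12 x))))) =
        S₂₃ (swap23 (S₁₂ (swap12 (S₂₃ (swap23 x))))) := by
      intro x
      have h1 := ((rel₃_ext_op12 hS x).trans (rel₃_ext_op23 hS _)).trans (rel₃_ext_op12 hS _)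
      have h2 := ((rel₃_ext_op23 hS x).trans (rel₃_ext_op12 hS _)).trans (rel₃_ext_op23 hS _)
      rw [show Equiv.swap (0 : Fin 3) 1 * (Equiv.swap 1 2 * Equiv.swap 0 1) =
        Equiv.swap 1 2 * (Equiv.swap 0 1 * Equiv.swap 1 2) by decide] at h1
      exact QuasiModule.Rel₃.unique hinj h1 h2
    -- Moving all flips to the right turns the middle operator of each word into S₁₃ and leaves a
    -- triple flip, which this argument cancels on both sides.
    have h := key (swap12 (swap23 (swap12 t)))
    simp only [S₁₂, S₂₃, swap12_swap12, swap23_ext_op12, swap12_ext_op23, swap12_ext_op13,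
      swap23_ext_op13] at h
    rw [swap12_swap23_swap12, swap23_swap23, swap12_swap12, swap23_swap23] at h
    exact h

end YangBaxter

/-! ## Euler operators -/

section Euler

/-- The operator `xᵢ ∂/∂xᵢ` on power series. -/
def euler {n : ℕ} (a : Fin n) (g : MvPowerSeries (Fin n) ℂ) : MvPowerSeries (Fin n) ℂ :=
  MvPowerSeries.X a * MvPowerSeries.pderiv ℂ a g

/-- The operators xᵢ∂/∂xᵢ are preferred to ∂/∂xᵢ because they scale each coefficient without
shifting exponents, hence act termwise on the sums `boxSum`. -/
theorem coeff_euler {n : ℕ} (a : Fin n) (g : MvPowerSeries (Fin n) ℂ) (m : Fin n →₀ ℕ) :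
    MvPowerSeries.coeff m (euler a g) = m a * MvPowerSeries.coeff m g := by
  rw [euler, MvPowerSeries.X, MvPowerSeries.coeff_monomial_mul]
  split_ifs with h
  · have h1 : m - Finsupp.single a 1 + Finsupp.single a 1 = m := tsub_add_cancel_of_le h
    rw [MvPowerSeries.coeff_pderiv, h1, one_mul, mul_comm]
    congr 1
    conv_rhs => rw [← h1]
    simp
  · have : m a = 0 := by
      by_contra h0
      exact h (Finsupp.single_le_iff.mpr (Nat.one_le_iff_ne_zero.mpr h0))
    simp [this]

theorem rename_euler {n : ℕ} (σ : Equiv.Perm (Fin n)) (a : Fin n) (g : MvPowerSeries (Fin n) ℂ) :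
    MvPowerSeries.rename σ.toEmbedding (euler a g) =
      euler (σ a) (MvPowerSeries.rename σ.toEmbedding g) := by
  ext m
  obtain ⟨d, rfl⟩ : ∃ d, m = Finsupp.embDomain σ.toEmbedding d :=
    ⟨Finsupp.embDomain σ.symm.toEmbedding m, Finsupp.ext fun b => by
      have h1 := Finsupp.embDomain_apply_self σ.toEmbedding
        (Finsupp.embDomain σ.symm.toEmbedding m) (σ.symm b)
      have h2 := Finsupp.embDomain_apply_self σ.symm.toEmbedding m b
      simp only [Equiv.coe_toEmbedding, Equiv.apply_symm_apply] at h1 h2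
      rw [h1, h2]⟩
  rw [coeff_euler, MvPowerSeries.coeff_embDomain_rename, MvPowerSeries.coeff_embDomain_rename,
    coeff_euler]
  have h := Finsupp.embDomain_apply_self σ.toEmbedding d a
  rw [Equiv.coe_toEmbedding] at h
  rw [h]

/-- The operator `xᵢ ∂/∂xᵢ` on `ℂ_*(x₁,…,xₙ)`. -/
def CStar.euler {n : ℕ} (a : Fin n) (h : CStar n) : CStar n :=
  CStar.ofPoly (MvPolynomial.X a) * CStar.pderiv a h

theorem CStar.euler_algebraMap {n : ℕ} (a : Fin n) (g : MvPowerSeries (Fin n) ℂ) :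
    CStar.euler a (algebraMap _ (CStar n) g) = algebraMap _ (CStar n) (QuasiVA.euler a g) := by
  rw [CStar.euler, CStar.pderiv_algebraMap, CStar.ofPoly, QuasiVA.euler, map_mul,
    MvPolynomial.coe_X]

theorem CStar.euler_mul {n : ℕ} (a : Fin n) (f g : CStar n) :
    CStar.euler a (f * g) = f * CStar.euler a g + CStar.euler a f * g := by
  simp only [CStar.euler, Derivation.leibniz, smul_eq_mul]
  ring

namespace Expansion

variable {n : ℕ} {W L E X : Type*} [AddCommGroup W] [Module ℂ W] [Field L] [Algebra ℂ L]
    [AddCommGroup E] [Module L E] {e : Expansion n W L E} {σ : Equiv.Perm (Fin n)}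

/-- Leibniz rule term by term: for a monomial with exponent m of g, the factor i a splits as (i a -
m a) + m a. -/
theorem euler_smul_algebraMap {a : Fin n} {θ : E →+ E} (hθ : ∀ F i, e.cf (θ F) i = i a • e.cf F i)
    (g : MvPowerSeries (Fin n) ℂ) (F : E) :
    θ (e.ι (algebraMap _ (CStar n) g) • F) = e.ι (algebraMap _ (CStar n) g) • θ F +
      e.ι (algebraMap _ (CStar n) (euler a g)) • F := by
  refine e.cf_injective (funext fun i => ?_)
  obtain ⟨N, h1, h2, h3⟩ := ((e.cf_smul g F i).and
    ((e.cf_smul g (θ F) i).and (e.cf_smul (euler a g) F i))).exists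
  rw [hθ, h1, map_add, Pi.add_apply, h2, h3, boxSum, boxSum, boxSum, Finset.smul_sum,
    ← Finset.sum_add_distrib]
  refine Finset.sum_congr rfl fun m _ => ?_
  rw [hθ, coeff_euler, expo_apply, mul_comm, mul_smul, ← smul_add, smul_comm]
  congr 1
  rw [← Int.cast_smul_eq_zsmul ℂ, ← Int.cast_smul_eq_zsmul ℂ, ← add_smul]
  congr 1
  push_cast
  ring

theorem euler_smul {a : Fin n} {θ : E →+ E} (hθ : ∀ F i, e.cf (θ F) i = i a • e.cf F i)
    (h : CStar n) (F : E) :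
    θ (e.ι h • F) = e.ι h • θ F + e.ι (CStar.euler a h) • F := by
  obtain ⟨q, g, hq, hg⟩ := CStar.exists_ofPoly_mul h
  refine smul_right_injective E (e.ι_ofPoly_ne_zero hq) ?_
  -- The rule for power series is applied to g = q·h acting on F and to q acting on h • F; the
  -- Leibniz rule for q·h then isolates q times the claim.
  have h1 := euler_smul_algebraMap hθ g F
  have h2 := euler_smul_algebraMap hθ q (e.ι h • F)
  rw [← CStar.ofPoly, smul_smul, ← map_mul, hg, h1, ← CStar.euler_algebraMap,
    ← CStar.euler_algebraMap, ← CStar.ofPoly, ← hg, CStar.euler_mul] at h2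
  simp only [map_add, map_mul, add_smul, mul_smul] at h2
  simp only [smul_add]
  rw [← add_assoc] at h2
  exact (add_right_cancel h2).symm

theorem Eqv.sub {F F' G G' : E} (h : e.Eqv σ F G) (h' : e.Eqv σ F' G') :
    e.Eqv σ (F - F') (G - G') :=
  fun i => by rw [map_sub, map_sub, Pi.sub_apply, Pi.sub_apply, h i, h' i]

/-- Differentiating pΦ = pΨ leaves an extra term, the derivative of p times Φ (or Ψ). Multiplying by
p once more turns it into a multiple of the known relation, which is subtracted; hence the
polynomial p². -/
theorem Rel.euler {θ : Fin n → E →+ E} (hθ : ∀ a F i, e.cf (θ a F) i = i a • e.cf F i)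
    {Φ Ψ : X → E} (h : e.Rel σ Φ Ψ) (a : Fin n) :
    e.Rel σ (fun x => θ a (Φ x)) (fun x => θ (σ a) (Ψ x)) := by
  obtain ⟨p, hp, h⟩ := h
  refine ⟨p * p, mul_ne_zero hp hp, fun x => ?_⟩
  have h1 : e.Eqv σ (θ a (e.ι (CStar.ofPoly p) • Φ x))
      (θ (σ a) (e.ι (CStar.rename σ.toEmbedding (CStar.ofPoly p)) • Ψ x)) := fun i => by
    rw [hθ, hθ, h x i]
    simp
  rw [euler_smul (hθ a), euler_smul (hθ (σ a))] at h1
  have h2 := (h x).smul (QuasiVA.euler a p)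
  have h3 := (h1.smul_ofPoly p).sub h2
  have h4 : CStar.rename σ.toEmbedding (algebraMap _ (CStar n) (QuasiVA.euler a p)) =
      CStar.euler (σ a) (CStar.rename σ.toEmbedding (CStar.ofPoly p)) := by
    rw [CStar.ofPoly, CStar.rename_algebraMap, CStar.rename_algebraMap, rename_euler,
      CStar.euler_algebraMap]
  rw [h4, ← CStar.euler_algebraMap, ← CStar.ofPoly] at h3
  simp only [smul_add, smul_smul, ← map_mul] at h3
  rw [mul_comm (CStar.ofPoly p) (CStar.euler a _),
    mul_comm _ (CStar.euler (σ a) _), add_sub_cancel_right, add_sub_cancel_right] at h3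
  simpa only [CStar.ofPoly_mul, map_mul] using h3

theorem cf_X_smul (e : Expansion n W L E) (a : Fin n) (F : E) (i : Fin n → ℤ) :
    e.cf (e.ι (CStar.ofPoly (MvPolynomial.X a)) • F) i = e.cf F (i - Pi.single a 1) := by
  obtain ⟨N, h, hN⟩ := ((e.cf_smul (MvPolynomial.X a : MvPolynomial (Fin n) ℂ) F i).and
    (eventually_ge_atTop 2)).exists
  refine h.trans ?_
  -- The exponent of the monomial xₐ, the only one with a nonzero coefficient; it fits in the cube
  -- because N ≥ 2.
  let m₀ : Fin n → Fin N := Function.update (fun _ => ⟨0, by omega⟩) a ⟨1, by omega⟩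
  have hm₀ : ∀ b, ((m₀ b : ℕ) : ℤ) = (Pi.single a 1 : Fin n → ℤ) b := fun b => by
    by_cases hb : b = a
    · subst hb
      simp [m₀]
    · simp [m₀, hb]
  have he : ∀ m : Fin n → Fin N, Finsupp.single a 1 = expo m ↔ m = m₀ := by
    intro m
    constructor
    · intro hm
      funext b
      refine Fin.ext ?_
      have h1 := DFunLike.congr_fun hm b
      have h2 := hm₀ b
      rw [expo_apply] at h1
      by_cases hb : b = a
      · subst hb
        simp at h1 h2
        omega
      · simp [hb] at h1 h2
        omega
    · rintro rfl
      ext b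
      have h2 := hm₀ b
      by_cases hb : b = a
      · subst hb
        simp at h2 ⊢
        omega
      · simp [hb] at h2 ⊢
        omega
  rw [boxSum, Finset.sum_eq_single m₀]
  · rw [MvPolynomial.coeff_coe, MvPolynomial.coeff_X, if_pos ((he m₀).mpr rfl), one_smul]
    exact congrArg _ (funext fun b => by rw [hm₀]; rfl)
  · intro m _ hm
    rw [MvPolynomial.coeff_coe, MvPolynomial.coeff_X, if_neg fun h => hm ((he m).mp h), zero_smul]
  · simp

end Expansion

/-- The operator `x ∂/∂x` for the outermost variable `x`. -/
def eulerOuter {R M : Type*} [CommRing R] [AddCommGroup M] [Module R M] :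
    LaurentModule R M →+ LaurentModule R M where
  toFun F := HahnModule.of R
    ⟨fun n => n • coeff F n, ((HahnModule.of R).symm F).isPWO_support.mono fun n hn h0 => hn (by
      change n • ((HahnModule.of R).symm F).coeff n = 0
      rw [h0, smul_zero])⟩
  map_zero' := coeff_ext fun n => smul_zero n
  map_add' F G := coeff_ext fun n => smul_add n (coeff F n) (coeff G n)

variable {W : Type*} [AddCommGroup W] [Module ℂ W]

/-- The operator `x₁ ∂/∂x₁` on `W((x₁))((x₂))`. -/
def eulerInner : E2 W →+ E2 W where
  toFun F := HahnModule.of L1 (((HahnModule.of L1).symm F).map eulerOuter.toZeroHom)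
  map_zero' := coeff_ext fun _ => (eulerOuter (R := ℂ) (M := W)).map_zero
  map_add' F G := coeff_ext fun n => (eulerOuter (R := ℂ) (M := W)).map_add (coeff F n) (coeff G n)

/-- The operators `xᵢ ∂/∂xᵢ` on `W((x₁))((x₂))`. -/
def euler₂ : Fin 2 → E2 W →+ E2 W := ![eulerInner, eulerOuter]

theorem cf₂_euler₂ (a : Fin 2) (F : E2 W) (i : Fin 2 → ℤ) :
    cf₂ (euler₂ a F) i = i a • cf₂ F i := by
  fin_cases a <;> rfl

end Euler

/-! ## The derivative property -/

section Derivative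

variable {V W : Type*} [AddCommGroup V] [Module ℂ V] [AddCommGroup W] [Module ℂ W]
  {A : NonlocalVertexAlgebra V} (M : QuasiModule A W)

/-- The binomial coefficient `n` over `j`, for integers `n` and `j`. -/
def intChoose (n j : ℤ) : ℤ := if 0 ≤ j then Ring.choose n j.toNat else 0

theorem intChoose_pascal (n j : ℤ) :
    intChoose (n + 1) j = intChoose n j + intChoose n (j - 1) := by
  rcases lt_trichotomy j 0 with h | rfl | h
  · simp [intChoose, not_le.mpr h, show ¬ (1 : ℤ) ≤ j by omega]
  · simp [intChoose]
  · obtain ⟨k, rfl⟩ : ∃ k : ℕ, j = k + 1 := ⟨(j - 1).toNat, by omega⟩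
    have h1 : ((k : ℤ) + 1).toNat = k + 1 := by omega
    rw [intChoose, intChoose, intChoose, if_pos h.le, if_pos h.le, if_pos (by omega), h1,
      add_sub_cancel_right, Int.toNat_natCast, Ring.choose_succ_succ, add_comm]

/-- If i or j is negative, the other exceeds i + j and both sides vanish. For i + j < 0 the symmetry
fails: this is the difference between the two expansions of a negative power of x₀ + x₂. -/
theorem intChoose_symm {i j : ℤ} (h : 0 ≤ i + j) : intChoose (i + j) j = intChoose (i + j) i := by
  obtain ⟨n, hn⟩ := Int.eq_ofNat_of_zero_le h
  have key : ∀ m : ℕ, n < m → intChoose n m = 0 := fun m hm => by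
    rw [intChoose, if_pos (by omega), Int.toNat_natCast, Ring.choose_natCast,
      Nat.choose_eq_zero_of_lt hm, Nat.cast_zero]
  have neg : ∀ m : ℤ, m < 0 → intChoose n m = 0 := fun m hm => if_neg (by omega)
  rw [hn]
  rcases lt_or_ge i 0 with hi | hi
  · obtain ⟨m, rfl⟩ := Int.eq_ofNat_of_zero_le (show 0 ≤ j by omega)
    rw [neg i hi, key m (by omega)]
  rcases lt_or_ge j 0 with hj | hj
  · obtain ⟨m, rfl⟩ := Int.eq_ofNat_of_zero_le hi
    rw [neg j hj, key m (by omega)]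
  obtain ⟨a, rfl⟩ := Int.eq_ofNat_of_zero_le hi
  obtain ⟨b, rfl⟩ := Int.eq_ofNat_of_zero_le hj
  rw [intChoose, intChoose, if_pos hj, if_pos hi, Int.toNat_natCast, Int.toNat_natCast,
    Ring.choose_natCast, Ring.choose_natCast]
  have : n = a + b := by omega
  subst this
  rw [Nat.choose_symm_add]

/-- `a(x₀+x₂)`, where `a(x) ∈ W((x))`. -/
def substAdd (a : Fld W) (w : W) : E2 W :=
  subst (apply₂ a (HahnModule.of ℂ (HahnSeries.single 0 w)))

theorem cf₂_substAdd (a : Fld W) (w : W) (i : Fin 2 → ℤ) :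
    cf₂ (substAdd a w) i = intChoose (i 0 + i 1) (i 1) • coeff (a w) (i 0 + i 1) := by
  have h0 : ∀ x, coeff₂ (apply₂ a (HahnModule.of ℂ (HahnSeries.single 0 w))) x 0 = coeff (a w) x := by
    intro x
    change coeff (a ((HahnSeries.single (0 : ℤ) w).coeff 0)) x = _
    rw [HahnSeries.coeff_single_same]
  have h1 : ∀ x y, y ≠ 0 →
      coeff₂ (apply₂ a (HahnModule.of ℂ (HahnSeries.single 0 w))) x y = 0 := by
    intro x y hy
    change coeff (a ((HahnSeries.single (0 : ℤ) w).coeff y)) x = _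
    rw [HahnSeries.coeff_single_of_ne hy, map_zero]
    rfl
  change substCoeff _ (i 1) (i 0) = _
  rw [substCoeff]
  rcases lt_or_ge (i 1) 0 with h | h
  · rw [intChoose, if_neg (by omega), zero_smul]
    exact finsum_eq_zero_of_forall_eq_zero fun k => by rw [h1 _ _ (by omega), smul_zero]
  · obtain ⟨k, hk⟩ := Int.eq_ofNat_of_zero_le h
    rw [hk, finsum_eq_single _ k fun m hm => by rw [h1 _ _ (by omega), smul_zero], sub_self, h0,
      intChoose, if_pos (by omega), Int.toNat_natCast]

/-- Multiplying a(x₀+x₂) by (x₀+x₂)^k amounts to shifting a(x) by x^k before substituting; each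
factor x₀ + x₂ is handled by Pascal's rule. -/
theorem cf₂_pow_smul_substAdd (a : Fld W) (w : W) (k : ℕ) (i : Fin 2 → ℤ) :
    cf₂ (iota (CStar.ofPoly ((MvPolynomial.X 0 + MvPolynomial.X 1) ^ k)) • substAdd a w) i =
      intChoose (i 0 + i 1) (i 1) • coeff (a w) (i 0 + i 1 - k) := by
  induction k generalizing i with
  | zero => simp [cf₂_substAdd, CStar.ofPoly_one]
  | succ k ih =>
    have hadd : CStar.ofPoly (MvPolynomial.X 0 + MvPolynomial.X 1 : MvPolynomial (Fin 2) ℂ) =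
        CStar.ofPoly (MvPolynomial.X 0) + CStar.ofPoly (MvPolynomial.X 1) := by
      simp [CStar.ofPoly]
    have hX : ∀ (a : Fin 2) (F : E2 W) (i : Fin 2 → ℤ),
        cf₂ (iota (CStar.ofPoly (MvPolynomial.X a)) • F) i = cf₂ F (i - Pi.single a 1) :=
      (expansion₂ W).cf_X_smul
    rw [pow_succ', CStar.ofPoly_mul, map_mul, mul_smul, hadd, map_add, add_smul, map_add,
      Pi.add_apply, hX, hX, ih, ih]
    simp only [Pi.sub_apply, Pi.single_eq_same, Pi.single_eq_of_ne (zero_ne_one' (Fin 2)),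
      Pi.single_eq_of_ne (one_ne_zero : (1 : Fin 2) ≠ 0), sub_zero]
    have h1 : i 0 - 1 + i 1 = i 0 + i 1 - 1 := by ring
    have h2 : i 0 + (i 1 - 1) = i 0 + i 1 - 1 := by ring
    rw [h1, h2, ← add_smul, ← intChoose_pascal]
    congr 2 <;> push_cast <;> ring

/-- A power of x₀ + x₂ clears the pole of a(x)w. Only nonnegative powers of x₀ + x₂ remain, and
their expansions are symmetric in x₀, x₂. -/
theorem exists_eqv_pow_smul_substAdd (a : Fld W) (w : W) : ∃ k : ℕ,
    (expansion₂ W).Eqv (Equiv.swap 0 1)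
      (iota (CStar.ofPoly ((MvPolynomial.X 0 + MvPolynomial.X 1) ^ k)) • substAdd a w)
      (iota (CStar.ofPoly ((MvPolynomial.X 0 + MvPolynomial.X 1) ^ k)) • substAdd a w) := by
  obtain ⟨N, hN⟩ := exists_coeff_eq_zero (a w)
  -- With this k, n < 0 implies n - k < N, so no negative power of x₀ + x₂ survives.
  refine ⟨(-N).toNat, fun i => ?_⟩
  refine (cf₂_pow_smul_substAdd a w _ i).trans (Eq.trans ?_ (cf₂_pow_smul_substAdd a w _ _).symm)
  have h0 : (i ∘ (Equiv.swap (0 : Fin 2) 1).symm) 0 = i 1 := by simp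
  have h1 : (i ∘ (Equiv.swap (0 : Fin 2) 1).symm) 1 = i 0 := by simp
  rw [h0, h1, add_comm (i 1)]
  rcases lt_or_ge (i 0 + i 1) 0 with h | h
  · rw [hN _ (by omega), smul_zero, smul_zero]
  · rw [intChoose_symm h]

/-- The substitution x₁ ↦ x₀ + x₂ is undone by x₀ ↦ x₁ - x₂. -/
theorem aeval_X_add_X_ne_zero {f : MvPolynomial (Fin 2) ℂ} (hf : f ≠ 0) :
    MvPolynomial.aeval
      ![MvPolynomial.X 0 + MvPolynomial.X 1, (MvPolynomial.X 1 : MvPolynomial (Fin 2) ℂ)] f ≠ 0 := by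
  intro h
  have h1 := congrArg (MvPolynomial.aeval
    ![MvPolynomial.X 0 - MvPolynomial.X 1, (MvPolynomial.X 1 : MvPolynomial (Fin 2) ℂ)]) h
  rw [map_zero, ← AlgHom.comp_apply] at h1
  have h2 : (MvPolynomial.aeval
      ![MvPolynomial.X 0 - MvPolynomial.X 1, (MvPolynomial.X 1 : MvPolynomial (Fin 2) ℂ)]).comp
      (MvPolynomial.aeval
        ![MvPolynomial.X 0 + MvPolynomial.X 1, (MvPolynomial.X 1 : MvPolynomial (Fin 2) ℂ)]) =
      AlgHom.id ℂ _ := by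
    refine MvPolynomial.algHom_ext fun i => ?_
    fin_cases i <;> simp
  rw [h2] at h1
  exact hf h1

namespace QuasiModule

/-- `Y_W(Y(v,x₀)1,x₂)w = Y_W(v,x₂+x₀)w`. -/
theorem apply₂_flip_vac (v : V) (w : W) :
    apply₂ (M.Y.flip w) (A.Y v A.vac) = substAdd (M.Y v) w := by
  obtain ⟨f, hf, h⟩ := M.quasi_assoc v A.vac w
  obtain ⟨k, hk⟩ := exists_eqv_pow_smul_substAdd (M.Y v) w
  rw [M.Y_vac, eqAfterMul_iff] at h
  set p := MvPolynomial.aeval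
    ![MvPolynomial.X 0 + MvPolynomial.X 1, (MvPolynomial.X 1 : MvPolynomial (Fin 2) ℂ)] f with hp
  set q : MvPolynomial (Fin 2) ℂ := (MvPolynomial.X 0 + MvPolynomial.X 1) ^ k with hq
  have hq' : CStar.rename (Equiv.swap (0 : Fin 2) 1).toEmbedding (CStar.ofPoly q) =
      CStar.ofPoly q := by
    rw [CStar.rename_ofPoly, hq]
    congr 1
    simp [add_comm]
  have h1 := h.smul_ofPoly q
  have h2 := hk.smul_ofPoly p
  rw [hq'] at h1
  simp only [smul_smul] at h1 h2
  rw [mul_comm] at h1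
  -- After multiplication by p·q, the iterate side and the expansion of Y_W(v,x₂+x₀)w in powers of
  -- x₀ both represent the same series, so they agree and the factor can be cancelled.
  have h3 := h1.unique h2
  rw [mul_comm ((expansion₂ W).ι (CStar.ofPoly q))] at h3
  refine smul_right_injective (E2 W) ?_ h3
  refine mul_ne_zero ?_ ((expansion₂ W).ι_ofPoly_ne_zero (pow_ne_zero k X_add_X_ne_zero))
  rw [← CStar.rename_perm_ofPoly]
  exact (expansion₂ W).ι_ofPoly_ne_zero
    (Expansion.rename_ofPoly_ne_zero (aeval_X_add_X_ne_zero hf) _)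

/-- `Y_W(𝒟v,x) = d/dx Y_W(v,x)`. -/
theorem coeff_Y_D (v : V) (w : W) (n : ℤ) :
    coeff (M.Y (A.D v) w) n = (n + 1) • coeff (M.Y v w) (n + 1) := by
  -- The coefficient of x₀ to the first power extracts 𝒟v from Y(v,x₀)1 and the first Taylor
  -- coefficient from Y_W(v,x₂+x₀)w.
  have h := congrArg (fun F => cf₂ F ![n, 1]) (M.apply₂_flip_vac v w)
  rw [cf₂_substAdd] at h
  have h1 : intChoose (n + 1) 1 = n + 1 := by
    rw [intChoose, if_pos zero_le_one]
    exact Ring.choose_one_right _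
  refine h.trans ?_
  simp [h1]

variable {M} {S : V ⊗[ℂ] V →ₗ[ℂ] CStar 2 ⊗[ℂ] (V ⊗[ℂ] V)}

theorem euler₂_zero_prod₂ (u v : V) (w : W) :
    euler₂ 0 (M.prod₂ (1 ⊗ₜ (u ⊗ₜ v)) w) =
      iota (CStar.ofPoly (MvPolynomial.X 0)) • M.prod₂ (1 ⊗ₜ (A.D u ⊗ₜ v)) w := by
  refine (expansion₂ W).cf_injective (funext fun i => ?_)
  refine (cf₂_euler₂ 0 _ i).trans (Eq.trans ?_ ((expansion₂ W).cf_X_smul 0 _ i).symm)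
  simp only [prod₂_tmul, map_one, one_smul]
  change i 0 • coeff (M.Y u (coeff (M.Y v w) (i 1))) (i 0) =
    coeff (M.Y (A.D u) (coeff (M.Y v w) ((i - Pi.single 0 1 : Fin 2 → ℤ) 1))) ((i - Pi.single 0 1 : Fin 2 → ℤ) 0)
  rw [coeff_Y_D]
  simp

theorem euler₂_one_prod₂ (t : CStar 2 ⊗[ℂ] (V ⊗[ℂ] V)) (w : W) :
    euler₂ 1 (M.prod₂ t w) = iota (CStar.ofPoly (MvPolynomial.X 1)) •
      M.prod₂ (LinearMap.rTensor (V ⊗[ℂ] V) (CStar.pderiv (1 : Fin 2)).toLinearMap t +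
        LinearMap.lTensor (CStar 2) (LinearMap.lTensor V A.D) t) w := by
  induction t using TensorProduct.induction_on with
  | zero => simp
  | add x y hx hy =>
    simp only [map_add, LinearMap.add_apply, hx, hy, smul_add]
    abel
  | tmul f x =>
    induction x using TensorProduct.induction_on with
    | zero => simp
    | add x y hx hy =>
      simp only [TensorProduct.tmul_add, map_add, LinearMap.add_apply, hx, hy, smul_add]
      abel
    | tmul u v =>
      have h1 : euler₂ 1 (apply₂ (M.Y u) (M.Y v w)) =
          iota (CStar.ofPoly (MvPolynomial.X 1)) • apply₂ (M.Y u) (M.Y (A.D v) w) := by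
        refine (expansion₂ W).cf_injective (funext fun i => ?_)
        refine (cf₂_euler₂ 1 _ i).trans (Eq.trans ?_ ((expansion₂ W).cf_X_smul 1 _ i).symm)
        change i 1 • coeff (M.Y u (coeff (M.Y v w) (i 1))) (i 0) =
          coeff (M.Y u (coeff (M.Y (A.D v) w) ((i - Pi.single 1 1 : Fin 2 → ℤ) 1))) ((i - Pi.single 1 1 : Fin 2 → ℤ) 0)
        rw [coeff_Y_D]
        simp only [Pi.sub_apply, Pi.single_eq_same, sub_add_cancel, map_zsmul,
          Pi.single_eq_of_ne (zero_ne_one' (Fin 2)), sub_zero]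
        rfl
      have h2 : euler₂ 1 (iota f • apply₂ (M.Y u) (M.Y v w)) =
          iota f • euler₂ 1 (apply₂ (M.Y u) (M.Y v w)) +
            iota (CStar.euler 1 f) • apply₂ (M.Y u) (M.Y v w) :=
        Expansion.euler_smul (e := expansion₂ W) (cf₂_euler₂ 1) f _
      rw [prod₂_tmul, LinearMap.rTensor_tmul, LinearMap.lTensor_tmul, LinearMap.lTensor_tmul,
        map_add, LinearMap.add_apply, prod₂_tmul, prod₂_tmul, smul_add, smul_smul, smul_smul]
      refine h2.trans ?_
      rw [h1, add_comm, smul_smul, mul_comm (iota (CStar.ofPoly _)) (iota f), ← map_mul, ← map_mul]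
      rfl

/-- Under x₁∂/∂x₁ the relation for u, v becomes x₁Y_W(𝒟u,x₁)Y_W(v,x₂) on the left. On the right x₁
is the second variable, so the derivative hits the coefficients of S(v ⊗ u) and its second tensor
factor. The relation for 𝒟u, v times x₁ has the same left side; uniqueness and cancelling the
variable finish. -/
theorem commutator_D (hinj : Function.Injective M.pi₃)
    (hS : ∀ u v, M.Rel₂ (1 ⊗ₜ (u ⊗ₜ v)) (S (v ⊗ₜ u))) :
    LinearMap.lTensor (CStar 2) (LinearMap.lTensor V A.D) ∘ₗ S - S ∘ₗ LinearMap.lTensor V A.D =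
      -(LinearMap.rTensor (V ⊗[ℂ] V) (CStar.pderiv (1 : Fin 2)).toLinearMap ∘ₗ S) := by
  refine TensorProduct.ext' fun v u => ?_
  have h1 := Expansion.Rel.euler (e := expansion₂ W) (θ := euler₂) cf₂_euler₂ (hS u v) 0
  have h2 : M.Rel₂ ((CStar.ofPoly (MvPolynomial.X 0) : CStar 2) • (1 ⊗ₜ (A.D u ⊗ₜ v)))
      ((CStar.ofPoly (MvPolynomial.X 1) : CStar 2) •
        (LinearMap.rTensor (V ⊗[ℂ] V) (CStar.pderiv (1 : Fin 2)).toLinearMap (S (v ⊗ₜ u)) +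
          LinearMap.lTensor (CStar 2) (LinearMap.lTensor V A.D) (S (v ⊗ₜ u)))) := by
    refine Eq.mp ?_ h1
    rw [Rel₂]
    congr 1
    · exact funext fun w => by rw [prod₂_smul, euler₂_zero_prod₂]
    · exact funext fun w => by rw [prod₂_smul, Equiv.swap_apply_left, euler₂_one_prod₂]
  have h3 := (hS (A.D u) v).smul (CStar.ofPoly (MvPolynomial.X 0))
  rw [CStar.rename_ofPoly, MvPolynomial.rename_X, Equiv.coe_toEmbedding,
    Equiv.swap_apply_left] at h3
  have h4 := (CStar.isUnit_ofPoly (X_ne_zero (1 : Fin 2))).smul_left_cancel.mp (Rel₂.unique hinj h3 h2)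
  simp only [LinearMap.sub_apply, LinearMap.comp_apply, LinearMap.neg_apply,
    LinearMap.lTensor_tmul]
  rw [h4]
  abel

end QuasiModule

end Derivative

/-! ## Substitutions and the rational case -/

section Rational

theorem laurent_algHom_ext {B : Type} [CommRing B] [Algebra ℂ B] {φ ψ : LaurentSeries ℂ →ₐ[ℂ] B}
    (h : ∀ f : PowerSeries ℂ, φ (algebraMap (PowerSeries ℂ) (LaurentSeries ℂ) f) =
      ψ (algebraMap (PowerSeries ℂ) (LaurentSeries ℂ) f)) : φ = ψ := by
  have : φ.toRingHom = ψ.toRingHom :=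
    IsLocalization.ringHom_ext (Submonoid.powers (PowerSeries.X : PowerSeries ℂ)) (RingHom.ext h)
  exact AlgHom.ext fun a => congrArg (fun f : LaurentSeries ℂ →+* B => f a) this

theorem laurentLift_algebraMap {B : Type} [CommRing B] [Algebra ℂ B] (φ : PowerSeries ℂ →ₐ[ℂ] B)
    (h : IsUnit (φ PowerSeries.X)) (f : PowerSeries ℂ) :
    laurentLift φ h (algebraMap (PowerSeries ℂ) (LaurentSeries ℂ) f) = φ f :=
  IsLocalization.lift_eq _ f

theorem hasSubst_coe {n : ℕ} {l : MvPolynomial (Fin n) ℂ}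
    (h0 : MvPolynomial.constantCoeff l = 0) :
    PowerSeries.HasSubst (l : MvPowerSeries (Fin n) ℂ) :=
  PowerSeries.HasSubst.of_constantCoeff_zero (by
    rw [← MvPowerSeries.coeff_zero_eq_constantCoeff_apply, MvPolynomial.coeff_coe]
    exact h0)

theorem laurentSubst_algebraMap {n : ℕ} (l : MvPolynomial (Fin n) ℂ)
    (h0 : MvPolynomial.constantCoeff l = 0) (hl : l ≠ 0) (f : PowerSeries ℂ) :
    laurentSubst l h0 hl (algebraMap (PowerSeries ℂ) (LaurentSeries ℂ) f) =
      algebraMap _ (CStar n) (PowerSeries.subst (l : MvPowerSeries (Fin n) ℂ) f) := by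
  rw [laurentSubst, laurentLift_algebraMap, AlgHom.comp_apply, PowerSeries.coe_substAlgHom]
  rfl

theorem rename_laurentSubst {m n : ℕ} (e : Fin m ↪ Fin n) {l : MvPolynomial (Fin m) ℂ}
    (h0 : MvPolynomial.constantCoeff l = 0) (hl : l ≠ 0) {l' : MvPolynomial (Fin n) ℂ}
    (h0' : MvPolynomial.constantCoeff l' = 0) (hl' : l' ≠ 0) (h : MvPolynomial.rename e l = l') :
    (CStar.rename e).comp (laurentSubst l h0 hl) = laurentSubst l' h0' hl' := by
  refine laurent_algHom_ext fun f => ?_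
  rw [AlgHom.comp_apply, laurentSubst_algebraMap, CStar.rename_algebraMap, laurentSubst_algebraMap]
  congr 1
  rw [MvPowerSeries.rename_eq_subst, PowerSeries.subst,
    MvPowerSeries.subst_comp_subst_apply (hasSubst_coe h0).const (MvPowerSeries.HasSubst.X_comp _),
    ← h, ← MvPowerSeries.rename_coe, MvPowerSeries.rename_eq_subst]
  rfl

/-- The substitution `x ↦ x₁ - x₂`, `z ↦ x₂ - x₃`. -/
def differences : Fin 2 → MvPolynomial (Fin 3) ℂ :=
  ![MvPolynomial.X 0 - MvPolynomial.X 1, MvPolynomial.X 1 - MvPolynomial.X 2]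

theorem constantCoeff_coe {n : ℕ} (l : MvPolynomial (Fin n) ℂ) :
    MvPowerSeries.constantCoeff (l : MvPowerSeries (Fin n) ℂ) = MvPolynomial.constantCoeff l := by
  rw [← MvPowerSeries.coeff_zero_eq_constantCoeff_apply, MvPolynomial.coeff_coe]
  rfl

theorem hasSubst_differences :
    MvPowerSeries.HasSubst fun i => (differences i : MvPowerSeries (Fin 3) ℂ) :=
  MvPowerSeries.hasSubst_of_constantCoeff_zero fun i => by
    rw [constantCoeff_coe]
    fin_cases i <;> simp [differences]

/-- A left inverse is the substitution x₁ = x + z, x₂ = z, x₃ = 0. -/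
theorem subst_differences_injective : Function.Injective
    (MvPowerSeries.subst (R := ℂ) fun i => (differences i : MvPowerSeries (Fin 3) ℂ)) := by
  let d : Fin 3 → MvPolynomial (Fin 2) ℂ :=
    ![MvPolynomial.X 0 + MvPolynomial.X 1, MvPolynomial.X 1, 0]
  have hd : MvPowerSeries.HasSubst fun i => (d i : MvPowerSeries (Fin 2) ℂ) :=
    MvPowerSeries.hasSubst_of_constantCoeff_zero fun i => by
      rw [constantCoeff_coe]
      fin_cases i <;> simp [d]
  refine Function.LeftInverse.injective
    (g := MvPowerSeries.subst (R := ℂ) fun i => (d i : MvPowerSeries (Fin 2) ℂ)) fun f => ?_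
  rw [MvPowerSeries.subst_comp_subst_apply hasSubst_differences hd]
  have : (fun s => MvPowerSeries.subst (fun i => (d i : MvPowerSeries (Fin 2) ℂ))
      (differences s : MvPowerSeries (Fin 3) ℂ)) = MvPowerSeries.X := by
    funext s
    rw [MvPowerSeries.subst_coe]
    fin_cases s <;> simp [differences, d]
  rw [this, MvPowerSeries.subst_self]
  rfl

theorem subst_differences_coe (p : MvPolynomial (Fin 2) ℂ) :
    MvPowerSeries.subst (fun i => (differences i : MvPowerSeries (Fin 3) ℂ))
      (p : MvPowerSeries (Fin 2) ℂ) =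
    (MvPolynomial.aeval differences p : MvPolynomial (Fin 3) ℂ) := by
  rw [MvPowerSeries.subst_coe]
  change _ = MvPolynomial.coeToMvPowerSeries.algHom ℂ (MvPolynomial.aeval differences p)
  rw [← AlgHom.comp_apply]
  refine DFunLike.congr_fun (MvPolynomial.algHom_ext fun i => ?_) p
  simp

/-- The substitution `f(x,z) ↦ f(x₁-x₂,x₂-x₃)` from `ℂ_*(x,z)` to `ℂ_*(x₁,x₂,x₃)`. -/
def substDifferences : CStar 2 →ₐ[ℂ] CStar 3 :=
  CStar.lift ((IsScalarTower.toAlgHom ℂ (MvPowerSeries (Fin 3) ℂ) (CStar 3)).comp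
    (MvPowerSeries.substAlgHom hasSubst_differences)) (by
    intro p hp
    rw [AlgHom.comp_apply, MvPowerSeries.coe_substAlgHom, subst_differences_coe]
    refine CStar.isUnit_ofPoly fun h0 => hp (MvPolynomial.coe_injective _ _ ?_)
    refine subst_differences_injective ?_
    simp only [subst_differences_coe, h0, map_zero])

theorem substDifferences_algebraMap (g : MvPowerSeries (Fin 2) ℂ) :
    substDifferences (algebraMap _ (CStar 2) g) = algebraMap _ (CStar 3)
      (MvPowerSeries.subst (fun i => (differences i : MvPowerSeries (Fin 3) ℂ)) g) := by
  rw [substDifferences, CStar.lift_algebraMap, AlgHom.comp_apply, MvPowerSeries.coe_substAlgHom]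
  rfl

theorem substDifferences_injective : Function.Injective substDifferences := by
  refine CStar.lift_injective substDifferences.toRingHom fun f g h => ?_
  simp only [AlgHom.toRingHom_eq_coe, RingHom.coe_coe, substDifferences_algebraMap] at h
  exact subst_differences_injective (IsLocalization.injective _ CStar.nonzeroPolys_le h)

theorem substDifferences_laurentSubst {l : MvPolynomial (Fin 2) ℂ}
    (h0 : MvPolynomial.constantCoeff l = 0) (hl : l ≠ 0) {l' : MvPolynomial (Fin 3) ℂ}
    (h0' : MvPolynomial.constantCoeff l' = 0) (hl' : l' ≠ 0)
    (h : MvPolynomial.aeval differences l = l') :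
    substDifferences.comp (laurentSubst l h0 hl) = laurentSubst l' h0' hl' := by
  refine laurent_algHom_ext fun f => ?_
  rw [AlgHom.comp_apply, laurentSubst_algebraMap, substDifferences_algebraMap,
    laurentSubst_algebraMap]
  congr 1
  rw [PowerSeries.subst,
    MvPowerSeries.subst_comp_subst_apply (hasSubst_coe h0).const hasSubst_differences,
    ← h, ← subst_differences_coe]
  rfl

/-- Under x = x₁ - x₂, z = x₂ - x₃ the arguments x, x + z, z of the rational equation become x₁ -
x₂, x₁ - x₃, x₂ - x₃, the arguments of the equation with two parameters. -/
theorem substDifferences_eq_rename (e : Fin 2 ↪ Fin 3) {l : MvPolynomial (Fin 2) ℂ}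
    (h0 : MvPolynomial.constantCoeff l = 0) (hl : l ≠ 0)
    (h : MvPolynomial.aeval differences l = MvPolynomial.X (e 0) - MvPolynomial.X (e 1)) :
    substDifferences.comp (laurentSubst l h0 hl) = (CStar.rename e).comp laurentSub := by
  have h1 : MvPolynomial.rename e (MvPolynomial.X 0 - MvPolynomial.X 1 : MvPolynomial (Fin 2) ℂ) =
      MvPolynomial.X (e 0) - MvPolynomial.X (e 1) := by simp
  have h2 : (MvPolynomial.X (e 0) - MvPolynomial.X (e 1) : MvPolynomial (Fin 3) ℂ) ≠ 0 := by
    rw [← h1]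
    exact fun h => X_sub_X_ne_zero (MvPolynomial.rename_injective e e.injective (by simpa using h))
  rw [substDifferences_laurentSubst h0 hl (by simp) h2 h, laurentSub,
    rename_laurentSubst e _ _ (by simp) h2 h1]

theorem laurentSub_injective : Function.Injective laurentSub := laurentSub.toRingHom.injective

theorem rename_swap_laurentSub :
    (CStar.rename (Equiv.swap (0 : Fin 2) 1).toEmbedding).comp laurentSub =
      laurentSub.comp laurentNeg := by
  have hne : (MvPolynomial.X 1 - MvPolynomial.X 0 : MvPolynomial (Fin 2) ℂ) ≠ 0 := by
    rw [← neg_sub]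
    exact neg_ne_zero.mpr X_sub_X_ne_zero
  rw [laurentSub, rename_laurentSubst _ _ _ (by simp) hne (by simp)]
  refine laurent_algHom_ext fun f => ?_
  have h1 : laurentNeg (algebraMap (PowerSeries ℂ) (LaurentSeries ℂ) f) =
      algebraMap (PowerSeries ℂ) (LaurentSeries ℂ) (PowerSeries.rescale (-1 : ℂ) f) := by
    rw [laurentNeg, laurentLift_algebraMap, AlgHom.comp_apply, ← PowerSeries.coe_rescaleAlgHom]
    rfl
  rw [AlgHom.comp_apply, h1, laurentSubst_algebraMap, laurentSubst_algebraMap,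
    PowerSeries.rescale_eq_subst,
    PowerSeries.subst_comp_subst_apply (PowerSeries.HasSubst.smul_X' _) (hasSubst_coe (by simp)),
    PowerSeries.subst_smul (hasSubst_coe (by simp)), PowerSeries.subst_X (hasSubst_coe (by simp))]
  congr 2
  rw [neg_one_smul, ← neg_sub]
  exact (MvPolynomial.coeToMvPowerSeries.ringHom (σ := Fin 2) (R := ℂ)).map_neg _

/-- Seen through the injective `laurentSub`, negation is the exchange of x₁ and x₂, which is an
involution. -/
theorem laurentNeg_comp_laurentNeg : laurentNeg.comp laurentNeg = AlgHom.id ℂ _ := by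
  refine AlgHom.ext fun f => laurentSub_injective ?_
  have h : ∀ x, laurentSub (laurentNeg x) =
      CStar.rename (Equiv.swap (0 : Fin 2) 1).toEmbedding (laurentSub x) := fun x =>
    (DFunLike.congr_fun rename_swap_laurentSub x).symm
  rw [AlgHom.comp_apply, h, h, CStar.rename_perm_mul, Equiv.swap_mul_self, CStar.rename_perm_one]
  rfl

/-! ### Descent of the Yang–Baxter and unitarity equations to T -/

variable {V : Type*} [AddCommGroup V] [Module ℂ V]

theorem isUnitaryRationalQYB_of_mapCoeff {T : V ⊗[ℂ] V →ₗ[ℂ] LaurentSeries ℂ ⊗[ℂ] (V ⊗[ℂ] V)}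
    (h : IsUnitaryQYB (mapCoeff laurentSub T)) : IsUnitaryRationalQYB T where
  unitary := by
    -- Unitarity of S descends to T₂₁(-x)T(x) = 1; the required form then follows by replacing x
    -- with -x.
    have h1 : ∀ x, ext (LaurentSeries ℂ) (op21 (mapCoeff laurentNeg T))
        (ext (LaurentSeries ℂ) T x) = x := by
      intro x
      refine Module.Flat.rTensor_preserves_injective_linearMap laurentSub.toLinearMap
        laurentSub_injective ?_
      have h2 := LinearMap.congr_fun h.unitary (LinearMap.rTensor _ laurentSub.toLinearMap x)
      rw [show CStar.pair (1 : Fin 2) 0 (by decide) = (Equiv.swap (0 : Fin 2) 1).toEmbedding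
        by decide, mapCoeff_mapCoeff, rename_swap_laurentSub, ← mapCoeff_mapCoeff, ← mapCoeff_op21,
        LinearMap.comp_apply, ext_mapCoeff_map, ext_mapCoeff_map] at h2
      exact h2
    refine LinearMap.ext fun x => ?_
    have hN : ∀ y : LaurentSeries ℂ ⊗[ℂ] (V ⊗[ℂ] V), LinearMap.rTensor _ laurentNeg.toLinearMap
        (LinearMap.rTensor _ laurentNeg.toLinearMap y) = y := by
      intro y
      rw [← LinearMap.comp_apply, ← LinearMap.rTensor_comp]
      have := congrArg AlgHom.toLinearMap laurentNeg_comp_laurentNeg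
      rw [AlgHom.comp_toLinearMap] at this
      rw [this]
      exact LinearMap.rTensor_id_apply _ _ y
    have h3 := congrArg (LinearMap.rTensor _ laurentNeg.toLinearMap)
      (h1 (LinearMap.rTensor _ laurentNeg.toLinearMap x))
    rw [← ext_mapCoeff_map, ← ext_mapCoeff_map, mapCoeff_op21, mapCoeff_mapCoeff,
      laurentNeg_comp_laurentNeg, mapCoeff_id, hN] at h3
    exact h3
  yangBaxter := by
    intro T₁₂ T₁₃ T₂₃
    refine LinearMap.ext fun x => ?_
    -- By flatness over ℂ the equation may be checked after the injective substitution x = x₁ - x₂,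
    -- z = x₂ - x₃, where it is the Yang–Baxter equation of S.
    refine Module.Flat.rTensor_preserves_injective_linearMap substDifferences.toLinearMap
      substDifferences_injective ?_
    have h1 := LinearMap.congr_fun h.yangBaxter (LinearMap.rTensor _ substDifferences.toLinearMap x)
    have h12 := substDifferences_eq_rename e12 (l := MvPolynomial.X 0) (by simp) (X_ne_zero 0)
      (by simp [differences])
    have h13 := substDifferences_eq_rename e13 (l := MvPolynomial.X 0 + MvPolynomial.X 1) (by simp)
      X_add_X_ne_zero (by simp [differences])
    have h23 := substDifferences_eq_rename e23 (l := MvPolynomial.X 1) (by simp) (X_ne_zero 1)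
      (by simp [differences])
    simp only [mapCoeff_mapCoeff] at h1
    rw [← h12, ← h13, ← h23] at h1
    simp only [← mapCoeff_mapCoeff, ← mapCoeff_op12, ← mapCoeff_op13, ← mapCoeff_op23,
      LinearMap.comp_apply, ext_mapCoeff_map] at h1
    simp only [mapCoeff_op12, mapCoeff_op13, mapCoeff_op23] at h1
    exact h1

end Rational

/-! ## The main theorem -/

section Main

variable {V W : Type*} [AddCommGroup V] [Module ℂ V] [AddCommGroup W] [Module ℂ W]
  {A : NonlocalVertexAlgebra V} {M : QuasiModule A W}

/-- If the vertex operators are `𝒮`-local, the coefficients of `S` are series in `x₁ - x₂`. -/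
theorem exists_eq_mapCoeff_laurentSub {S : V ⊗[ℂ] V →ₗ[ℂ] CStar 2 ⊗[ℂ] (V ⊗[ℂ] V)}
    (hS : ∀ (u v : V) (n : ℕ) (f : Fin n → CStar 2) (v' u' : Fin n → V),
      M.PseudoLocalRel u v f v' u' → S (v ⊗ₜ u) = ∑ i, f i ⊗ₜ (v' i ⊗ₜ u' i))
    (hloc : IsSLocal (Set.range M.Y)) :
    ∃ T : V ⊗[ℂ] V →ₗ[ℂ] LaurentSeries ℂ ⊗[ℂ] (V ⊗[ℂ] V), S = mapCoeff laurentSub T := by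
  let Λ := LinearMap.rTensor (V ⊗[ℂ] V) laurentSub.toLinearMap
  have hΛ : Function.Injective Λ :=
    Module.Flat.rTensor_preserves_injective_linearMap laurentSub.toLinearMap laurentSub_injective
  have hrange : ∀ t, S t ∈ LinearMap.range Λ := by
    intro t
    induction t using TensorProduct.induction_on with
    | zero => simp
    | add x y hx hy =>
      rw [map_add]
      exact add_mem hx hy
    | tmul v u =>
      obtain ⟨r, ψ, a, b, k, hab, h⟩ := hloc _ ⟨u, rfl⟩ _ ⟨v, rfl⟩
      choose a' ha' using fun i => (hab i).1
      choose b' hb' using fun i => (hab i).2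
      -- An 𝒮-locality relation is a pseudo-locality relation with polynomial (x₁-x₂)^k, so it
      -- computes S(v ⊗ u).
      have h1 : M.PseudoLocalRel u v (fun i => laurentSub (ψ i)) a' b' := by
        refine ⟨_, pow_ne_zero k X_sub_X_ne_zero, fun w => ?_⟩
        simp only [ha', hb']
        exact h w
      rw [hS u v r _ _ _ h1]
      exact ⟨∑ i, ψ i ⊗ₜ (a' i ⊗ₜ b' i), by simp [Λ]⟩
  refine ⟨(LinearEquiv.ofInjective Λ hΛ).symm.toLinearMap ∘ₗ S.codRestrict _ hrange,
    LinearMap.ext fun t => ?_⟩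
  have := (LinearEquiv.ofInjective Λ hΛ).apply_symm_apply (S.codRestrict _ hrange t)
  exact (congrArg Subtype.val this).symm

end Main

end QuasiVA

end

theorem theorem4p7 {V W : Type*} [AddCommGroup V] [Module ℂ V] [AddCommGroup W] [Module ℂ W]
    (A : QuasiVA.NonlocalVertexAlgebra V) (M : QuasiVA.QuasiModule A W)
    (hpl : M.IsPseudoLocal) (hinj : Function.Injective M.pi₃) :
    ∃ S : V ⊗[ℂ] V →ₗ[ℂ] QuasiVA.CStar 2 ⊗[ℂ] (V ⊗[ℂ] V),
      -- `S(x₂,x₁)(v ⊗ u) = ∑ᵢ vᵢ ⊗ uᵢ ⊗ fᵢ(x₂,x₁)` exactly when the pseudo-locality relation holds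
      (∀ (u v : V) (n : ℕ) (f : Fin n → QuasiVA.CStar 2) (v' u' : Fin n → V),
        M.PseudoLocalRel u v f v' u' ↔ S (v ⊗ₜ u) = ∑ i, f i ⊗ₜ (v' i ⊗ₜ u' i)) ∧
      -- uniqueness
      (∀ S' : V ⊗[ℂ] V →ₗ[ℂ] QuasiVA.CStar 2 ⊗[ℂ] (V ⊗[ℂ] V), M.IsSQuasiModule S' → S' = S) ∧
      QuasiVA.IsUnitaryQYB S ∧
      M.IsSQuasiModule S ∧
      -- `[1 ⊗ 𝒟, S(x₁,x₂)] = -∂S(x₁,x₂)/∂x₂`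
      LinearMap.lTensor (QuasiVA.CStar 2) (LinearMap.lTensor V A.D) ∘ₗ S -
          S ∘ₗ LinearMap.lTensor V A.D =
        -(LinearMap.rTensor (V ⊗[ℂ] V) (QuasiVA.CStar.pderiv (1 : Fin 2)).toLinearMap ∘ₗ S) ∧
      -- the case of `𝒮`-local vertex operators
      (QuasiVA.IsSLocal (Set.range M.Y) →
        ∃ T : V ⊗[ℂ] V →ₗ[ℂ] LaurentSeries ℂ ⊗[ℂ] (V ⊗[ℂ] V),
          QuasiVA.IsUnitaryRationalQYB T ∧ S = QuasiVA.mapCoeff QuasiVA.laurentSub T) := by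
  obtain ⟨S, hS⟩ := QuasiVA.QuasiModule.exists_operator hpl hinj
  have hiff : ∀ (u v : V) (n : ℕ) (f : Fin n → QuasiVA.CStar 2) (v' u' : Fin n → V),
      M.PseudoLocalRel u v f v' u' ↔ S (v ⊗ₜ u) = ∑ i, f i ⊗ₜ (v' i ⊗ₜ u' i) := by
    intro u v n f v' u'
    rw [QuasiVA.QuasiModule.pseudoLocalRel_iff]
    refine ⟨fun h => QuasiVA.QuasiModule.Rel₂.unique hinj (hS u v) h, fun h => ?_⟩
    rw [← h]
    exact hS u v
  have hQYB := QuasiVA.isUnitaryQYB hinj hS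
  refine ⟨S, hiff, fun S' hS' => TensorProduct.ext' fun v u => ?_, hQYB,
    (QuasiVA.QuasiModule.isSQuasiModule_iff S).mpr hS,
    QuasiVA.QuasiModule.commutator_D hinj hS, fun hloc => ?_⟩
  · exact QuasiVA.QuasiModule.Rel₂.unique hinj
      ((QuasiVA.QuasiModule.isSQuasiModule_iff S').mp hS' u v) (hS u v)
  · obtain ⟨T, rfl⟩ := QuasiVA.exists_eq_mapCoeff_laurentSub
      (fun u v n f v' u' => (hiff u v n f v' u').mp) hloc
    exact ⟨T, QuasiVA.isUnitaryRationalQYB_of_mapCoeff hQYB, rfl⟩
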